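/- **Conventions.** All systems are finite dimensional with fixed orthonormal bases. A state is a positive semi-definite operator of trace one; a channel is a completely positive trace-preserving linear map. Alice holds the systems $A,\hat A$ and Bob holds $B,\hat B$. * For an integer $d\ge 1$, the swap channel on two $d$-dimensional systems $A,B$ is $\mathcal S^d_{AB}(\omega)=S\omega S^\dagger$ with $S=\sum_{i,j=0}^{d-1}|i\rangle\langle j|_A\otimes|j\rangle\langle i|_B$. * For an integer $d_{\hat A}\ge 2$ and $F\in[0,1]$, the isotropic state of fidelity $F$ and dimension $d_{\hat A}$ on $\hat A\hat B$ (with $d_{\hat B}=d_{\hat A}$) is $$\rho^{(F,d_{\hat A})}_{\hat A\hat B}=F\,\Phi_{\hat A\hat B}+(1-F)\frac{I_{\hat A\hat B}-\Phi_{\hat A\hat B}}{d_{\hat A}^2-1},\qquad \Phi_{\hat A\hat B}=\frac1{d_{\hat A}}\sum_{i,j}|i\rangle\langle j|_{\hat A}\otimes|i\rangle\langle j|_{\hat B}.$$ * The diamond distance of two channels with input system $C$ is $\|\mathcal N-\mathcal M\|_\diamond=\sup_{R,\rho_{RC}}\|(\mathrm{id}_R\otimes\mathcal N)(\rho_{RC})-(\mathrm{id}_R\otimes\mathcal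 M)(\rho_{RC})\|_1$, the supremum being over all finite-dimensional systems $R$ and all states $\rho_{RC}$, where $\|X\|_1=\operatorname{Tr}\sqrt{X^\dagger X}$. * A bipartite channel is LOCC if it is implemented by a protocol of finitely many rounds, in each of which one party applies a quantum instrument with finitely many outcomes to its own systems (possibly changing their dimension) and announces the outcome, on which all later operations may depend, and which ends with local channels of both parties. A bipartite channel $\mathcal P_{AB\to A'B'}$ is C-PPT-P (completely positive-partial-transpose preserving) if $T_{B'}\circ\mathcal P\circ T_B$ is completely positive, where $T$ denotes the transpose on Bob's systems. * For a resource state $\rho_{\hat A\hat B}$, the LOCC and PPT simulation errors of the swap channel are $$e_{\mathrm{LOCC}}(\mathcal S^d_{AB},\rho_{\hat A\hat B})=\inf_{\mathcal L}\tfrac12\big\|\mathcal S^d_{AB}-\mathcal L(\,\cdot\otimes\rho_{\hat A\hat B})\big\|_\diamond,\qquad e_{\mathrm{PPT}}(\mathcal S^d_{AB},\rho_{\hat A\hat B})=\inf_{\mathcal P}\tfrac12\big\|\mathcal S^d_{AB}-\mathcal P(\,\cdot\otimes\rho_{\hat A\hat B})\big\|_\diamond,$$ where $\mathcal L$ and $\mathcal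 P$ range over the channels $AB\hat A\hat B\to AB$ (Alice: $A\hat A\to A$, Bob: $B\hat B\to B$) that are LOCC and C-PPT-P, respectively. **Proposition.** Let $d\ge 1$ and $d_{\hat A}\ge 2$ be integers and $F\in[0,1]$. Then $$e_{\mathrm{PPT}}\big(\mathcal S^d_{AB},\rho^{(F,d_{\hat A})}_{\hat A\hat B}\big)=\begin{cases}1-\dfrac1{d^2}&\text{if }F\le\dfrac1{d_{\hat A}},\\[2mm] 1-\dfrac{F d_{\hat A}}{d^2}&\text{if }F>\dfrac1{d_{\hat A}}\text{ and }d_{\hat A}\le d^2,\\[2mm] \dfrac{(1-\frac1{d^2})(1-F)}{1-\frac1{d_{\hat A}}}&\text{if }F>\dfrac1{d_{\hat A}}\text{ and }d_{\hat A}>d^2.\end{cases}$$ Moreover, if $F\le\frac1{d_{\hat A}}$, or if $F>\frac1{d_{\hat A}}$ and $d_{\hat A}\le d^2$, then $$e_{\mathrm{PPT}}\big(\mathcal S^d_{AB},\rho^{(F,d_{\hat A})}_{\hat A\hat B}\big)=e_{\mathrm{LOCC}}\big(\mathcal S^d_{AB},\rho^{(F,d_{\hat A})}_{\hat A\hat B}\big).$$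 -/

import Mathlib

open scoped Matrix Kronecker ComplexOrder

noncomputable section

namespace Teleport

/-- Operators on the finite-dimensional Hilbert space `ℂ^a` with a fixed orthonormal basis
indexed by `a`. The index type of a composite system is the product of the index types. -/
abbrev Op (a : Type) := Matrix a a ℂ

/-- Linear maps taking operators of system `a` to operators of system `b`. -/
abbrev SuperOp (a b : Type) := Op a →ₗ[ℂ] Op b

/-- A quantum state (density operator). -/
def IsState {a : Type} [Fintype a] (ρ : Op a) : Prop :=
  ρ.PosSemidef ∧ ρ.trace = 1

/-- The tensor product `E ⊗ G` of two linear maps on operators: the linear map with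
`X ⊗ Y ↦ E X ⊗ G Y`, written out on the matrix units `|i⟩⟨i'| ⊗ |j⟩⟨j'|`. -/
def tensorMap {a b a' b' : Type} [Fintype a] [DecidableEq a] [Fintype b] [DecidableEq b]
    (E : SuperOp a a') (G : SuperOp b b') : SuperOp (a × b) (a' × b') where
  toFun X := ∑ i : a, ∑ i' : a, ∑ j : b, ∑ j' : b,
    X (i, j) (i', j') • (E (Matrix.single i i' 1) ⊗ₖ G (Matrix.single j j' 1))
  map_add' X Y := by
    simp only [Matrix.add_apply, add_smul, Finset.sum_add_distrib]
  map_smul' c X := by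
    simp only [Matrix.smul_apply, smul_assoc, Finset.smul_sum, RingHom.id_apply]

/-- Complete positivity: `id_R ⊗ N` preserves positive semi-definiteness for every
finite-dimensional reference system `R`. -/
def IsCP {a b : Type} [Fintype a] [DecidableEq a] (N : SuperOp a b) : Prop :=
  ∀ (r : ℕ) (X : Op (Fin r × a)), X.PosSemidef →
    (tensorMap (LinearMap.id : SuperOp (Fin r) (Fin r)) N X).PosSemidef

/-- Trace preservation. -/
def IsTP {a b : Type} [Fintype a] [Fintype b] (N : SuperOp a b) : Prop :=
  ∀ X : Op a, (N X).trace = X.trace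

/-- Quantum channels: completely positive and trace-preserving maps. -/
def IsChannel {a b : Type} [Fintype a] [DecidableEq a] [Fintype b] (N : SuperOp a b) : Prop :=
  IsCP N ∧ IsTP N

/-- Quantum instruments with outcomes in `Fin n`: completely positive maps whose sum is trace
preserving. -/
def IsInstrument {a b : Type} [Fintype a] [DecidableEq a] [Fintype b] {n : ℕ}
    (E : Fin n → SuperOp a b) : Prop :=
  (∀ x, IsCP (E x)) ∧ IsTP (∑ x, E x)

/-- Bipartite channels implementable by local operations and classical communication, Alice
holding the first tensor factor and Bob the second. A protocol either ends with local channels on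
both sides, or starts with one party applying a quantum instrument to her or his system (which may
change its dimension) and announcing the outcome `x`, after which the parties go on with an LOCC
protocol `L x` that may depend on `x`. The number of rounds is finite and arbitrary. -/
inductive IsLOCC {a' b' : Type} [Fintype a'] [Fintype b'] :
    ∀ {a b : Type} [Fintype a] [DecidableEq a] [Fintype b] [DecidableEq b],
      SuperOp (a × b) (a' × b') → Prop
  | localOps {a b : Type} [Fintype a] [DecidableEq a] [Fintype b] [DecidableEq b]
      (E : SuperOp a a') (G : SuperOp b b') (hE : IsChannel E) (hG : IsChannel G) :
      IsLOCC (tensorMap E G)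
  | alice {a b c : Type} [Fintype a] [DecidableEq a] [Fintype b] [DecidableEq b]
      [Fintype c] [DecidableEq c] {n : ℕ}
      (E : Fin n → SuperOp a c) (L : Fin n → SuperOp (c × b) (a' × b'))
      (hE : IsInstrument E) (hL : ∀ x, IsLOCC (L x)) :
      IsLOCC (∑ x, L x ∘ₗ tensorMap (E x) (LinearMap.id : SuperOp b b))
  | bob {a b c : Type} [Fintype a] [DecidableEq a] [Fintype b] [DecidableEq b]
      [Fintype c] [DecidableEq c] {n : ℕ}
      (G : Fin n → SuperOp b c) (L : Fin n → SuperOp (a × c) (a' × b'))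
      (hG : IsInstrument G) (hL : ∀ x, IsLOCC (L x)) :
      IsLOCC (∑ x, L x ∘ₗ tensorMap (LinearMap.id : SuperOp a a) (G x))

/-- The partial transpose on Bob's system. -/
def partialTranspose (a b : Type) : SuperOp (a × b) (a × b) where
  toFun X := Matrix.of fun p q => X (p.1, q.2) (q.1, p.2)
  map_add' _ _ := rfl
  map_smul' _ _ := rfl

/-- Completely PPT-preserving (C-PPT-P) bipartite channels. -/
def IsCPPTP {a b a' b' : Type} [Fintype a] [DecidableEq a] [Fintype b] [DecidableEq b]
    [Fintype a'] [Fintype b'] (P : SuperOp (a × b) (a' × b')) : Prop :=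
  IsChannel P ∧ IsCP (partialTranspose a' b' ∘ₗ P ∘ₗ partialTranspose a b)

/-- The trace norm `‖X‖₁ = Tr √(X† X)`. -/
def traceNorm {a : Type} [Fintype a] [DecidableEq a] (X : Op a) : ℝ :=
  (cfc Real.sqrt (Xᴴ * X)).trace.re

/-- The diamond distance `‖N - M‖_⋄`: the supremum of `‖(id_R ⊗ N)(ρ) - (id_R ⊗ M)(ρ)‖₁` over all
finite-dimensional reference systems `R` and all states `ρ` of `R` and the input system. -/
def diamondDist {a b : Type} [Fintype a] [DecidableEq a] [Fintype b] [DecidableEq b]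
    (N M : SuperOp a b) : ℝ :=
  sSup {t : ℝ | ∃ (r : ℕ) (ρ : Op (Fin r × a)), IsState ρ ∧
    t = traceNorm (tensorMap (LinearMap.id : SuperOp (Fin r) (Fin r)) N ρ -
      tensorMap (LinearMap.id : SuperOp (Fin r) (Fin r)) M ρ)}

/-- Appending the resource state: `ω_{AB} ↦ ω_{AB} ⊗ ρ_{ÂB̂}`, with the systems reordered so that
Alice holds `AÂ` and Bob holds `BB̂`. -/
def attach {a b r s : Type} (ρ : Op (r × s)) : SuperOp (a × b) ((a × r) × (b × s)) where
  toFun ω := (ω ⊗ₖ ρ).submatrix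
    (Equiv.prodProdProdComm a r b s) (Equiv.prodProdProdComm a r b s)
  map_add' ω τ := by
    rw [Matrix.add_kronecker]; rfl
  map_smul' c ω := by
    rw [Matrix.smul_kronecker]; rfl

/-- The simulation `ω_{AB} ↦ P(ω_{AB} ⊗ ρ_{ÂB̂})` obtained from the bipartite channel `P` and the
resource state `ρ`. -/
def simulation {a b r s a' b' : Type} (P : SuperOp ((a × r) × (b × s)) (a' × b'))
    (ρ : Op (r × s)) : SuperOp (a × b) (a' × b') :=
  P ∘ₗ attach ρ

section Errors

variable {a b r s a' b' : Type} [Fintype a] [DecidableEq a] [Fintype b] [DecidableEq b]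
  [Fintype r] [DecidableEq r] [Fintype s] [DecidableEq s]
  [Fintype a'] [DecidableEq a'] [Fintype b'] [DecidableEq b']

/-- The simulation error of the bipartite channel `N` with resource state `ρ`, in normalized
diamond distance, minimized over all LOCC channels. -/
def errLOCC (N : SuperOp (a × b) (a' × b')) (ρ : Op (r × s)) : ℝ :=
  sInf {e : ℝ | ∃ L : SuperOp ((a × r) × (b × s)) (a' × b'),
    IsLOCC L ∧ e = 1 / 2 * diamondDist N (simulation L ρ)}

/-- The simulation error of the bipartite channel `N` with resource state `ρ`, in normalized
diamond distance, minimized over all C-PPT-P channels. -/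
def errPPT (N : SuperOp (a × b) (a' × b')) (ρ : Op (r × s)) : ℝ :=
  sInf {e : ℝ | ∃ P : SuperOp ((a × r) × (b × s)) (a' × b'),
    IsCPPTP P ∧ e = 1 / 2 * diamondDist N (simulation P ρ)}

end Errors

/-- The unitary swap operator `∑_{i,j} |i⟩⟨j| ⊗ |j⟩⟨i|` on two `d`-dimensional systems. -/
def swapOp (d : ℕ) : Op (Fin d × Fin d) :=
  ∑ i : Fin d, ∑ j : Fin d, (Matrix.single i j 1 : Op (Fin d)) ⊗ₖ (Matrix.single j i 1 : Op (Fin d))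

/-- The unitary swap channel `ω ↦ S ω S†`. -/
def swapChannel (d : ℕ) : SuperOp (Fin d × Fin d) (Fin d × Fin d) where
  toFun ω := swapOp d * ω * (swapOp d)ᴴ
  map_add' ω τ := by rw [mul_add, add_mul]
  map_smul' c ω := by rw [mul_smul_comm, smul_mul_assoc, RingHom.id_apply]

/-- The maximally entangled state `(1/d) ∑_{i,j} |i⟩⟨j| ⊗ |i⟩⟨j|`. -/
def maxEntangled (d : ℕ) : Op (Fin d × Fin d) :=
  (1 / (d : ℂ)) • ∑ i : Fin d, ∑ j : Fin d,
    (Matrix.single i j 1 : Op (Fin d)) ⊗ₖ (Matrix.single i j 1 : Op (Fin d))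

/-- The isotropic state `F Φ + (1 - F) (I - Φ) / (D² - 1)` of fidelity `F` and dimension `D`. -/
def isotropicState (D : ℕ) (F : ℝ) : Op (Fin D × Fin D) :=
  (F : ℂ) • maxEntangled D + ((1 - F : ℂ) / ((D : ℂ) ^ 2 - 1)) • (1 - maxEntangled D)

end Teleport

end

/-!
Every error is governed by one number, the swap fidelity `p` of a simulation, that is the normalized
overlap of its Choi matrix with that of the swap channel. If the simulation dominates
`p • swapChannel d` in the completely positive order, then it is within `2 (1 - p)` of the swap
channel in diamond distance; conversely, testing with the Choi state of the swap channel shows that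
the distance is at least `2 (1 - p)`. So the error is `1 - p` for the largest fidelity `p`.

For the upper bound on `p`, a fidelity is a trace of products of Choi matrices, so it is unchanged
when everything is partially transposed on Bob's side. The swap channel then becomes an operator
bounded by the identity, whence `|p| ≤ Tr ρ / d²` for every resource `ρ`, normalized or not, with
positive partial transpose. The isotropic state is a combination of `1 ± D Φ`, whose partial
transposes are `1 ± S ≥ 0`, which gives `p ≤ max 1 (F D) / d²`; writing it instead with `1 + D Φ`
and `Φ`, and using `p ≤ 1` for the latter, gives the bound for large `D`.

These bounds are attained. For small `F` the parties ignore the resource. For `D ≤ d²`, teleporting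
a system of dimension `d²` through an embedded maximally entangled state of rank `D` yields the
swap channel with weight `D / d²`. For `d² < D` the parties test the resource for `Φ` and apply the
swap if it passes and a partially depolarized swap otherwise; this is not LOCC, but the noise can be
tuned to make it PPT preserving.
-/

noncomputable section

namespace Teleport

section Positivity

variable {n : Type*}

theorem posSemidef_one_add_smul_permMatrix [Finite n] [DecidableEq n] {σ : Equiv.Perm n}
    (hσ : σ * σ = 1) {ε : ℝ} (hε : ε * ε = 1) : (1 + (ε : ℂ) • σ.permMatrix ℂ).PosSemidef := by
  have := Fintype.ofFinite n
  set M := 1 + (ε : ℂ) • σ.permMatrix ℂ with hM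
  have hM_herm : Mᴴ = M := by
    simp [hM, Matrix.conjTranspose_permMatrix, inv_eq_of_mul_eq_one_right hσ]
  have hM_sq : M * M = (2 : ℂ) • M := by
    have hε' : (ε : ℂ) * ε = 1 := mod_cast hε
    simp only [hM, mul_add, add_mul, mul_one, one_mul, smul_mul_smul_comm,
      ← Matrix.permMatrix_mul, hσ, Matrix.permMatrix_one, hε']
    module
  have hM_eq : M = (2⁻¹ : ℂ) • (Mᴴ * M) := by rw [hM_herm, hM_sq, inv_smul_smul₀ two_ne_zero]
  rw [hM_eq]
  exact (Matrix.posSemidef_conjTranspose_mul_self M).smul (by simp)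

variable [Fintype n]

theorem posSemidef_smul_one_sub_vecMulVec [DecidableEq n] (v : n → ℂ) :
    ((star v ⬝ᵥ v) • (1 : Matrix n n ℂ) - Matrix.vecMulVec v (star v)).PosSemidef := by
  have hv : 0 ≤ star v ⬝ᵥ v := dotProduct_star_self_nonneg v
  set s := star v ⬝ᵥ v with hs
  set M : Matrix n n ℂ := s • 1 - Matrix.vecMulVec v (star v) with hM
  rcases eq_or_ne s 0 with h | h
  · have : v = 0 := dotProduct_star_self_eq_zero.1 (hs ▸ h)
    simpa [hM, h, this] using Matrix.PosSemidef.zero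
  have hM_herm : Mᴴ = M :=
    (Matrix.PosSemidef.one.smul hv).1.sub (Matrix.posSemidef_vecMulVec_self_star v).1
  have hM_sq : M * M = s • M := by
    simp only [hM, Matrix.sub_mul, Matrix.mul_sub, Matrix.smul_mul, Matrix.mul_smul, one_mul,
      mul_one, Matrix.vecMulVec_mul_vecMulVec, ← hs, Matrix.vecMulVec_smul]
    module
  have hM_eq : M = s⁻¹ • (Mᴴ * M) := by rw [hM_herm, hM_sq, inv_smul_smul₀ h]
  rw [hM_eq]
  exact (Matrix.posSemidef_conjTranspose_mul_self M).smul (inv_nonneg.2 hv)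

open scoped MatrixOrder in
theorem trace_mul_nonneg {A B : Matrix n n ℂ} (hA : A.PosSemidef)
    (hB : B.PosSemidef) : 0 ≤ (A * B).trace := by
  classical
  obtain ⟨C, rfl⟩ := CStarAlgebra.nonneg_iff_eq_star_mul_self.mp hA.nonneg
  rw [mul_assoc, Matrix.trace_mul_comm, Matrix.star_eq_conjTranspose]
  exact (hB.mul_mul_conjTranspose_same C).trace_nonneg

theorem trace_mul_vecMulVec (X : Matrix n n ℂ) (v w : n → ℂ) :
    (X * Matrix.vecMulVec v w).trace = w ⬝ᵥ X *ᵥ v := by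
  rw [Matrix.mul_vecMulVec, Matrix.trace_vecMulVec, dotProduct_comm]

theorem dotProduct_mulVec_le_trace {X : Matrix n n ℂ} (hX : X.PosSemidef)
    (v : n → ℂ) : star v ⬝ᵥ X *ᵥ v ≤ (star v ⬝ᵥ v) * X.trace := by
  classical
  have h := trace_mul_nonneg hX (posSemidef_smul_one_sub_vecMulVec v)
  rwa [Matrix.mul_sub, Matrix.trace_sub, trace_mul_vecMulVec, Matrix.mul_smul, mul_one,
    Matrix.trace_smul, smul_eq_mul, sub_nonneg] at h

theorem re_trace_mul_permMatrix_le [DecidableEq n] {X : Matrix n n ℂ} (hX : X.PosSemidef)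
    {σ : Equiv.Perm n} (hσ : σ * σ = 1) {ε : ℝ} (hε : ε * ε = 1) :
    ε * (X * σ.permMatrix ℂ).trace.re ≤ X.trace.re := by
  have hε' : (-ε) * (-ε) = 1 := by rwa [neg_mul_neg]
  have h := trace_mul_nonneg hX (posSemidef_one_add_smul_permMatrix hσ hε')
  rw [mul_add, mul_one, Matrix.trace_add, Matrix.mul_smul, Matrix.trace_smul, smul_eq_mul] at h
  have h_re := (Complex.nonneg_iff.1 h).1
  rw [Complex.add_re, Complex.re_ofReal_mul] at h_re
  linarith

end Positivity

section TraceNorm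

variable {a : Type} [Fintype a] [DecidableEq a]

theorem traceNorm_eq_cfc_abs {X : Op a} (hX : X.IsHermitian) :
    traceNorm X = (cfc (fun x : ℝ => |x|) X).trace.re := by
  have hX' : IsSelfAdjoint X := hX
  rw [traceNorm, hX.eq, ← pow_two, ← cfc_comp_pow (R := ℝ) Real.sqrt 2 X]
  simp only [Real.sqrt_sq_eq_abs]

theorem continuousOn_real_spectrum (X : Op a) (f : ℝ → ℝ) : ContinuousOn f (spectrum ℝ X) :=
  X.finite_real_spectrum.continuousOn f

open scoped MatrixOrder in
theorem exists_re_trace_mul_eq_traceNorm {X : Op a} (hX : X.IsHermitian) :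
    ∃ S : Op a, (1 - S).PosSemidef ∧ (1 + S).PosSemidef ∧ (S * X).trace.re = traceNorm X := by
  have hX' : IsSelfAdjoint X := hX
  have hcont := continuousOn_real_spectrum X
  refine ⟨cfc (fun x : ℝ => (SignType.sign x : ℝ)) X, ?_, ?_, ?_⟩
  · rw [← cfc_one ℝ X, ← cfc_sub _ _ _ (hcont _) (hcont _), ← Matrix.nonneg_iff_posSemidef]
    refine cfc_nonneg fun x _ => ?_
    cases SignType.sign x <;> norm_num
  · rw [← cfc_one ℝ X, ← cfc_add _ _ _ (hcont _) (hcont _), ← Matrix.nonneg_iff_posSemidef]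
    refine cfc_nonneg fun x _ => ?_
    cases SignType.sign x <;> norm_num
  · nth_rw 2 [← cfc_id ℝ X]
    rw [traceNorm_eq_cfc_abs hX, ← cfc_mul _ _ _ (hcont _) (hcont _)]
    simp only [id_eq, sign_mul_self]

open scoped MatrixOrder in
theorem re_trace_mul_le_traceNorm {X S : Op a} (hX : X.IsHermitian) (hS : (1 - S).PosSemidef)
    (hS' : (1 + S).PosSemidef) : (S * X).trace.re ≤ traceNorm X := by
  have hX' : IsSelfAdjoint X := hX
  have hcont := continuousOn_real_spectrum X
  have h_sub : (cfc (fun x : ℝ => |x|) X - X).PosSemidef := by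
    have h : 0 ≤ cfc (fun x : ℝ => |x| - x) X := cfc_nonneg fun x _ => sub_nonneg.2 (le_abs_self x)
    rwa [cfc_sub _ _ _ (hcont _) (hcont _), cfc_id' ℝ X, Matrix.nonneg_iff_posSemidef] at h
  have h_add : (cfc (fun x : ℝ => |x|) X + X).PosSemidef := by
    have h : 0 ≤ cfc (fun x : ℝ => |x| + x) X :=
      cfc_nonneg fun x _ => neg_le_iff_add_nonneg'.1 (neg_abs_le x)
    rwa [cfc_add _ _ _ (hcont _) (hcont _), cfc_id' ℝ X, Matrix.nonneg_iff_posSemidef] at h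
  have h₁ := (Complex.nonneg_iff.1 (trace_mul_nonneg hS h_add)).1
  have h₂ := (Complex.nonneg_iff.1 (trace_mul_nonneg hS' h_sub)).1
  simp only [sub_mul, add_mul, mul_sub, mul_add, one_mul, Matrix.trace_sub, Matrix.trace_add,
    Complex.sub_re, Complex.add_re] at h₁ h₂
  rw [traceNorm_eq_cfc_abs hX]
  linarith

theorem traceNorm_sub_le {A B : Op a} (hA : A.PosSemidef) (hB : B.PosSemidef) :
    traceNorm (A - B) ≤ A.trace.re + B.trace.re := by
  obtain ⟨S, hS, hS', h_eq⟩ := exists_re_trace_mul_eq_traceNorm (hA.1.sub hB.1)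
  have hSA := (Complex.nonneg_iff.1 (trace_mul_nonneg hS hA)).1
  have hSB := (Complex.nonneg_iff.1 (trace_mul_nonneg hS' hB)).1
  simp only [sub_mul, add_mul, mul_sub, one_mul, Matrix.trace_sub, Matrix.trace_add,
    Complex.sub_re, Complex.add_re] at hSA hSB h_eq
  linarith

theorem le_traceNorm {X : Op a} (hX : X.IsHermitian) {v : a → ℂ} (hv : star v ⬝ᵥ v = 1) :
    2 * (star v ⬝ᵥ X *ᵥ v).re - X.trace.re ≤ traceNorm X := by
  set S : Op a := (2 : ℂ) • Matrix.vecMulVec v (star v) - 1 with hS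
  have hS_le : (1 - S).PosSemidef := by
    have h := (posSemidef_smul_one_sub_vecMulVec v).smul (zero_le_two : (0 : ℂ) ≤ 2)
    rw [hv, one_smul] at h
    convert h using 1
    rw [hS]
    module
  have hS_ge : (1 + S).PosSemidef := by
    rw [hS, add_sub_cancel]
    exact (Matrix.posSemidef_vecMulVec_self_star v).smul zero_le_two
  have h := re_trace_mul_le_traceNorm hX hS_le hS_ge
  rw [Matrix.trace_mul_comm, hS, mul_sub, mul_one, Matrix.mul_smul, Matrix.trace_sub,
    Matrix.trace_smul, trace_mul_vecMulVec] at h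
  simpa using h

end TraceNorm

section TensorMap

variable {a b c a' b' c' : Type}

theorem linearMap_op_ext [Finite a] [DecidableEq a] {V : Type*} [AddCommMonoid V] [Module ℂ V]
    {M N : Op a →ₗ[ℂ] V}
    (h : ∀ i j, M (Matrix.single i j 1) = N (Matrix.single i j 1)) : M = N :=
  Matrix.ext_linearMap _ fun i j => LinearMap.ext_ring (h i j)

theorem linearMap_op_ext_kronecker [Finite a] [Finite b] {V : Type*} [AddCommMonoid V]
    [Module ℂ V] {M N : Op (a × b) →ₗ[ℂ] V}
    (h : ∀ X Y, M (X ⊗ₖ Y) = N (X ⊗ₖ Y)) : M = N := by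
  classical
  refine linearMap_op_ext fun i j => ?_
  simpa only [Matrix.single_kronecker_single, mul_one] using
    h (Matrix.single i.1 j.1 1) (Matrix.single i.2 j.2 1)

variable [Fintype a] [DecidableEq a] [Fintype b] [DecidableEq b]

theorem superOp_apply (N : SuperOp a b') (X : Op a) :
    N X = ∑ i, ∑ j, X i j • N (Matrix.single i j 1) := by
  conv_lhs => rw [Matrix.matrix_eq_sum_single X]
  simp only [map_sum, ← map_smul, Matrix.smul_single, smul_eq_mul, mul_one]

theorem tensorMap_kronecker (E : SuperOp a a') (G : SuperOp b b') (X : Op a) (Y : Op b) :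
    tensorMap E G (X ⊗ₖ Y) = E X ⊗ₖ G Y := by
  have h_sum : tensorMap E G (X ⊗ₖ Y) = ∑ i, ∑ i', ∑ j, ∑ j', (X i i' * Y j j') •
      (E (Matrix.single i i' 1) ⊗ₖ G (Matrix.single j j' 1)) := rfl
  rw [h_sum, superOp_apply E X, superOp_apply G Y]
  ext ⟨k, l⟩ ⟨k', l'⟩
  simp only [Matrix.sum_apply, Matrix.smul_apply, Matrix.kroneckerMap_apply, smul_eq_mul,
    Finset.sum_mul]
  simp only [Finset.mul_sum, mul_mul_mul_comm]

theorem tensorMap_single (E : SuperOp a a') (G : SuperOp b b') (i i' : a) (j j' : b) :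
    tensorMap E G (Matrix.single (i, j) (i', j') 1) =
      E (Matrix.single i i' 1) ⊗ₖ G (Matrix.single j j' 1) := by
  rw [← tensorMap_kronecker, Matrix.single_kronecker_single, mul_one]

/-- The tensor product of superoperators, as a bilinear map. -/
def tensorMapBilin :
    SuperOp a a' →ₗ[ℂ] SuperOp b b' →ₗ[ℂ] SuperOp (a × b) (a' × b') :=
  LinearMap.mk₂ ℂ tensorMap
    (fun E F G => linearMap_op_ext_kronecker fun X Y => by
      simp only [tensorMap_kronecker, LinearMap.add_apply, Matrix.add_kronecker])
    (fun z E G => linearMap_op_ext_kronecker fun X Y => by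
      simp only [tensorMap_kronecker, LinearMap.smul_apply, Matrix.smul_kronecker])
    (fun E F G => linearMap_op_ext_kronecker fun X Y => by
      simp only [tensorMap_kronecker, LinearMap.add_apply, Matrix.kronecker_add])
    (fun z E G => linearMap_op_ext_kronecker fun X Y => by
      simp only [tensorMap_kronecker, LinearMap.smul_apply, Matrix.kronecker_smul])

theorem tensorMap_sum_left {ι : Type*} (s : Finset ι) (E : ι → SuperOp a a')
    (G : SuperOp b b') : tensorMap (∑ x ∈ s, E x) G = ∑ x ∈ s, tensorMap (E x) G :=
  map_sum (tensorMapBilin.flip G) E s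

theorem tensorMap_sum_right {ι : Type*} (s : Finset ι) (E : SuperOp a a')
    (G : ι → SuperOp b b') : tensorMap E (∑ x ∈ s, G x) = ∑ x ∈ s, tensorMap E (G x) :=
  map_sum (tensorMapBilin E) G s

theorem tensorMap_id_id :
    tensorMap (LinearMap.id : SuperOp a a) (LinearMap.id : SuperOp b b) = LinearMap.id :=
  linearMap_op_ext_kronecker fun X Y => tensorMap_kronecker _ _ X Y

theorem tensorMap_comp [Fintype c] [DecidableEq c] [Fintype c'] [DecidableEq c']
    (E' : SuperOp c a') (E : SuperOp a c) (G' : SuperOp c' b') (G : SuperOp b c') :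
    tensorMap (E' ∘ₗ E) (G' ∘ₗ G) = tensorMap E' G' ∘ₗ tensorMap E G :=
  linearMap_op_ext_kronecker fun X Y => by
    simp only [LinearMap.comp_apply, tensorMap_kronecker]

theorem tensorMap_id_apply (N : SuperOp b b') (X : Op (a × b)) (p p' : a) (k l : b') :
    tensorMap (LinearMap.id : SuperOp a a) N X (p, k) (p', l) =
      N (Matrix.of fun i j => X (p, i) (p', j)) k l := by
  rw [superOp_apply N]
  simp only [tensorMap, LinearMap.coe_mk, AddHom.coe_mk, Matrix.sum_apply, Matrix.smul_apply,
    Matrix.kroneckerMap_apply, smul_eq_mul, LinearMap.id_apply, Matrix.of_apply]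
  rw [Finset.sum_eq_single p, Finset.sum_eq_single p']
  · simp
  · intro y _ hy; simp [hy]
  · simp
  · intro x _ hx; simp [hx]
  · simp

end TensorMap

section Choi

variable {a b c a' b' r : Type} [DecidableEq a]

theorem IsCP.id [Fintype a] : IsCP (LinearMap.id : SuperOp a a) := fun r X hX => by
  rwa [tensorMap_id_id]

theorem IsCP.comp [Fintype a] [Fintype b] [DecidableEq b] {N : SuperOp b c} {M : SuperOp a b}
    (hN : IsCP N) (hM : IsCP M) : IsCP (N ∘ₗ M) := fun r X hX => by
  rw [← LinearMap.id_comp (LinearMap.id : SuperOp (Fin r) (Fin r)), tensorMap_comp]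
  exact hN r _ (hM r X hX)

/-- The Choi matrix `∑_{i,j} |i⟩⟨j| ⊗ N(|i⟩⟨j|)`. -/
def choi : SuperOp a b →ₗ[ℂ] Op (a × b) where
  toFun N := Matrix.of fun p q => N (Matrix.single p.1 q.1 1) p.2 q.2
  map_add' _ _ := rfl
  map_smul' _ _ := rfl

@[simp]
theorem choi_apply (N : SuperOp a b) (p q : a × b) :
    choi N p q = N (Matrix.single p.1 q.1 1) p.2 q.2 := rfl

/-- The unnormalized maximally entangled vector `∑_i |i⟩ ⊗ |e i⟩`. -/
def entangledVec (e : r ≃ a) : r × a → ℂ := fun p => if e p.1 = p.2 then 1 else 0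

theorem star_entangledVec (e : r ≃ a) : star (entangledVec e) = entangledVec e := by
  ext p
  simp only [Pi.star_apply, entangledVec, apply_ite star, star_one, star_zero]

variable [Fintype a]

theorem superOp_apply_eq_sum_choi (N : SuperOp a b) (X : Op a) (k l : b) :
    N X k l = ∑ i, ∑ j, X i j * choi N (i, k) (j, l) := by
  rw [superOp_apply N X]
  simp only [Matrix.sum_apply, Matrix.smul_apply, smul_eq_mul, choi_apply]

theorem trace_choi [Fintype b] (N : SuperOp a b) : (choi N).trace = (N 1).trace := by
  have h_one : (1 : Op a) = ∑ i, Matrix.single i i 1 := Matrix.sum_single_one.symm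
  rw [h_one, map_sum, Matrix.trace_sum]
  simp only [Matrix.trace, Matrix.diag_apply, choi_apply, Fintype.sum_prod_type]

variable [Fintype r]

theorem entangledVec_dotProduct_self (e : r ≃ a) :
    star (entangledVec e) ⬝ᵥ entangledVec e = Fintype.card a := by
  simp [dotProduct, Fintype.sum_prod_type, entangledVec,
    Fintype.card_congr e]

theorem tensorMap_id_entangledVec [DecidableEq r] (e : r ≃ a) (N : SuperOp a b) :
    tensorMap (LinearMap.id : SuperOp r r) N
        (Matrix.vecMulVec (entangledVec e) (star (entangledVec e))) =
      (choi N).submatrix (Prod.map e id) (Prod.map e id) := by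
  ext ⟨p, k⟩ ⟨q, l⟩
  have h_single : (Matrix.of fun i j => Matrix.vecMulVec (entangledVec e)
      (star (entangledVec e)) (p, i) (q, j)) = Matrix.single (e p) (e q) (1 : ℂ) := by
    ext i j
    rw [Matrix.of_apply, star_entangledVec, Matrix.vecMulVec_apply, Matrix.single_apply]
    simp only [entangledVec, ite_and, ite_mul, one_mul, zero_mul]
  rw [tensorMap_id_apply, h_single]
  rfl

theorem posSemidef_sum_snd {m n : Type*} [Finite m] [Fintype n]
    {Z : Matrix (m × n) (m × n) ℂ} (hZ : Z.PosSemidef) :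
    (Matrix.of fun p q => ∑ i, ∑ j, Z (p, i) (q, j)).PosSemidef := by
  classical
  have := Fintype.ofFinite m
  set V : Matrix m (m × n) ℂ := Matrix.of fun p q => if p = q.1 then 1 else 0 with hV
  convert hZ.mul_mul_conjTranspose_same V using 1
  ext p q
  simp only [Matrix.of_apply, Matrix.mul_apply, Matrix.conjTranspose_apply, hV,
    Fintype.sum_prod_type, Finset.sum_mul]
  rw [Finset.sum_comm]
  simp

variable [Finite b]

theorem posSemidef_tensorMap_id_of_choi [DecidableEq r] {N : SuperOp a b}
    (hN : (choi N).PosSemidef) {X : Op (r × a)} (hX : X.PosSemidef) :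
    (tensorMap (LinearMap.id : SuperOp r r) N X).PosSemidef := by
  have h := (hX.submatrix fun x : (r × b) × a => (x.1.1, x.2)).hadamard
    (hN.submatrix fun x : (r × b) × a => (x.2, x.1.2))
  convert posSemidef_sum_snd h using 1
  ext ⟨p, k⟩ ⟨q, l⟩
  rw [tensorMap_id_apply, superOp_apply_eq_sum_choi]
  rfl

theorem isCP_iff_posSemidef_choi {N : SuperOp a b} : IsCP N ↔ (choi N).PosSemidef := by
  refine ⟨fun hN => ?_, fun hN r X hX => posSemidef_tensorMap_id_of_choi hN hX⟩
  let e := (Fintype.equivFin a).symm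
  have h := hN _ _ (Matrix.posSemidef_vecMulVec_self_star (entangledVec e))
  rw [tensorMap_id_entangledVec] at h
  convert h.submatrix (Prod.map e.symm id) using 1
  ext p q
  simp

theorem IsCP.add {M N : SuperOp a b} (hM : IsCP M) (hN : IsCP N) : IsCP (M + N) := by
  rw [isCP_iff_posSemidef_choi, map_add] at *
  exact hM.add hN

theorem IsCP.smul {N : SuperOp a b} (hN : IsCP N) {t : ℂ} (ht : 0 ≤ t) : IsCP (t • N) := by
  rw [isCP_iff_posSemidef_choi, map_smul] at *
  exact hN.smul ht

theorem IsCP.sum {ι : Type*} {s : Finset ι} {N : ι → SuperOp a b} (h : ∀ i ∈ s, IsCP (N i)) :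
    IsCP (∑ i ∈ s, N i) := by
  simp only [isCP_iff_posSemidef_choi, map_sum] at *
  exact Matrix.posSemidef_sum s h

end Choi

section Tensor

variable {a b a' b' : Type} [Fintype a] [DecidableEq a] [Fintype b] [DecidableEq b]

theorem choi_tensorMap (E : SuperOp a a') (G : SuperOp b b') :
    choi (tensorMap E G) = (choi E ⊗ₖ choi G).submatrix
      (Equiv.prodProdProdComm a b a' b') (Equiv.prodProdProdComm a b a' b') := by
  ext ⟨⟨i, j⟩, k⟩ ⟨⟨i', j'⟩, l⟩
  simp only [choi_apply, tensorMap_single]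
  rfl

theorem IsCP.tensor [Finite a'] [Finite b'] {E : SuperOp a a'} {G : SuperOp b b'} (hE : IsCP E)
    (hG : IsCP G) : IsCP (tensorMap E G) := by
  classical
  have := Fintype.ofFinite a'
  have := Fintype.ofFinite b'
  rw [isCP_iff_posSemidef_choi, choi_tensorMap]
  exact ((isCP_iff_posSemidef_choi.1 hE).kronecker (isCP_iff_posSemidef_choi.1 hG)).submatrix _

end Tensor

section TracePreserving

variable {a b c a' b' : Type} [Fintype a] [Fintype b]

theorem IsTP.id : IsTP (LinearMap.id : SuperOp a a) := fun _ => rfl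

theorem IsTP.comp [Fintype c] {N : SuperOp b c} {M : SuperOp a b} (hN : IsTP N) (hM : IsTP M) :
    IsTP (N ∘ₗ M) := fun X => (hN (M X)).trans (hM X)

theorem IsTP.tensor [Fintype a'] [Fintype b'] [DecidableEq a] [DecidableEq b]
    {E : SuperOp a a'} {G : SuperOp b b'} (hE : IsTP E) (hG : IsTP G) :
    IsTP (tensorMap E G) := by
  suffices h : Matrix.traceLinearMap (a' × b') ℂ ℂ ∘ₗ tensorMap E G =
      Matrix.traceLinearMap (a × b) ℂ ℂ from fun X => LinearMap.congr_fun h X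
  refine Matrix.ext_linearMap _ fun i j => LinearMap.ext_ring ?_
  rw [← Prod.mk.eta (p := i), ← Prod.mk.eta (p := j)]
  simp only [LinearMap.comp_apply, Matrix.singleLinearMap_apply, Matrix.traceLinearMap_apply,
    tensorMap_single, Matrix.trace_kronecker, hE _, hG _]
  rw [← Matrix.trace_kronecker, Matrix.single_kronecker_single, mul_one]

theorem IsTP.trace_tensorMap_id [DecidableEq a] {r : Type} [Fintype r] [DecidableEq r]
    {N : SuperOp a b} (hN : IsTP N) (X : Op (r × a)) :
    (tensorMap (LinearMap.id : SuperOp r r) N X).trace = X.trace :=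
  IsTP.id.tensor hN X

end TracePreserving

section Conj

variable {a b c a' b' : Type} [Fintype a]

/-- The superoperator `X ↦ K X K†` with the single Kraus operator `K`. -/
def conjMap (K : Matrix b a ℂ) : SuperOp a b where
  toFun X := K * X * Kᴴ
  map_add' X Y := by rw [Matrix.mul_add, Matrix.add_mul]
  map_smul' z X := by rw [Matrix.mul_smul, Matrix.smul_mul, RingHom.id_apply]

@[simp]
theorem conjMap_apply (K : Matrix b a ℂ) (X : Op a) : conjMap K X = K * X * Kᴴ := rfl

theorem conjMap_smul (z : ℂ) (K : Matrix b a ℂ) :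
    conjMap (z • K) = (z * star z) • conjMap K := by
  ext1 X
  simp only [conjMap_apply, LinearMap.smul_apply, Matrix.conjTranspose_smul, Matrix.smul_mul,
    Matrix.mul_smul, smul_smul, mul_comm]

theorem conjMap_comp [Fintype b] (L : Matrix c b ℂ) (K : Matrix b a ℂ) :
    conjMap L ∘ₗ conjMap K = conjMap (L * K) := by
  ext1 X
  simp only [LinearMap.comp_apply, conjMap_apply, Matrix.conjTranspose_mul, Matrix.mul_assoc]

theorem conjMap_vecMulVec (K : Matrix b a ℂ) (v : a → ℂ) :
    conjMap K (Matrix.vecMulVec v (star v)) = Matrix.vecMulVec (K *ᵥ v) (star (K *ᵥ v)) := by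
  rw [conjMap_apply, Matrix.mul_vecMulVec, Matrix.vecMulVec_mul, ← Matrix.star_mulVec]

variable [DecidableEq a]

theorem conjMap_one : conjMap (1 : Op a) = LinearMap.id := by
  ext1 X
  simp only [conjMap_apply, Matrix.conjTranspose_one, one_mul, mul_one, LinearMap.id_apply]

theorem tensorMap_conjMap [Fintype b] [DecidableEq b] (K : Matrix a' a ℂ) (L : Matrix b' b ℂ) :
    tensorMap (conjMap K) (conjMap L) = conjMap (K ⊗ₖ L) :=
  linearMap_op_ext_kronecker fun X Y => by
    simp only [tensorMap_kronecker, conjMap_apply, Matrix.conjTranspose_kronecker,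
      Matrix.mul_kronecker_mul]

theorem choi_conjMap (K : Matrix b a ℂ) :
    choi (conjMap K) =
      Matrix.vecMulVec (fun p => K p.2 p.1) (star fun p : a × b => K p.2 p.1) := by
  ext ⟨i, k⟩ ⟨j, l⟩
  simp [Matrix.mul_apply, Matrix.single_apply, Matrix.vecMulVec_apply, ite_and]

theorem isCP_conjMap [Finite b] (K : Matrix b a ℂ) : IsCP (conjMap K) := by
  rw [isCP_iff_posSemidef_choi, choi_conjMap]
  exact Matrix.posSemidef_vecMulVec_self_star _

theorem isTP_sum_conjMap [Fintype b] {κ : Type*} [Fintype κ] {K : κ → Matrix b a ℂ}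
    (hK : ∑ x, (K x)ᴴ * K x = 1) : IsTP (∑ x, conjMap (K x)) := fun X => by
  simp only [LinearMap.sum_apply, Matrix.trace_sum, conjMap_apply]
  simp only [Matrix.trace_mul_cycle (K _) X, ← Matrix.trace_sum, ← Finset.sum_mul, hK, one_mul]

theorem isInstrument_conjMap [Fintype b] {n : ℕ} {K : Fin n → Matrix b a ℂ}
    (hK : ∑ x, (K x)ᴴ * K x = 1) : IsInstrument fun x => conjMap (K x) :=
  ⟨fun x => isCP_conjMap (K x), isTP_sum_conjMap hK⟩

theorem isChannel_conjMap [Fintype b] {K : Matrix b a ℂ} (hK : Kᴴ * K = 1) :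
    IsChannel (conjMap K) :=
  ⟨isCP_conjMap K, by
    simpa using isTP_sum_conjMap (K := fun _ : Unit => K) (by simpa using hK)⟩

theorem isCP_card_smul_sum_conjMap_sub [Finite b] {κ : Type*} [Fintype κ]
    (K : κ → Matrix b a ℂ) :
    IsCP ((Fintype.card κ : ℂ) • ∑ x, conjMap (K x) - conjMap (∑ x, K x)) := by
  classical
  set V : Matrix (a × b) κ ℂ := Matrix.of fun p x => K x p.2 p.1 with hV
  have h := (posSemidef_smul_one_sub_vecMulVec (1 : κ → ℂ)).mul_mul_conjTranspose_same V
  have h_card : star (1 : κ → ℂ) ⬝ᵥ 1 = Fintype.card κ := by simp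
  have h_sum : V * Vᴴ = ∑ x, choi (conjMap (K x)) := by
    ext p q
    simp only [Matrix.mul_apply, Matrix.sum_apply, choi_conjMap, Matrix.vecMulVec_apply]
    rfl
  have h_mulVec : V *ᵥ 1 = fun p => (∑ x, K x) p.2 p.1 := by
    ext p
    simp only [hV, Matrix.mulVec, dotProduct, Matrix.of_apply, Pi.one_apply, mul_one,
      Matrix.sum_apply]
  rw [h_card, Matrix.mul_sub, Matrix.sub_mul, Matrix.mul_smul, Matrix.mul_one, Matrix.smul_mul,
    h_sum, Matrix.mul_vecMulVec, Matrix.vecMulVec_mul, ← Matrix.star_mulVec, h_mulVec] at h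
  rwa [isCP_iff_posSemidef_choi, map_sub, map_smul, map_sum, choi_conjMap]

end Conj

section Replacer

variable {a b a' b' : Type} [Fintype a]

/-- The superoperator `X ↦ tr(X) σ` that discards its input and prepares `σ`. -/
def replacer (a : Type) [Fintype a] (σ : Op b) : SuperOp a b :=
  (Matrix.traceLinearMap a ℂ ℂ).smulRight σ

@[simp]
theorem replacer_apply (σ : Op b) (X : Op a) : replacer a σ X = X.trace • σ := rfl

variable [DecidableEq a]

theorem choi_replacer (σ : Op b) : choi (replacer a σ) = 1 ⊗ₖ σ := by
  ext ⟨i, k⟩ ⟨j, l⟩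
  by_cases h : i = j <;> simp [h, Matrix.trace_single_eq_of_ne]

theorem isCP_replacer [Finite b] {σ : Op b} (hσ : σ.PosSemidef) : IsCP (replacer a σ) := by
  classical
  have := Fintype.ofFinite b
  rw [isCP_iff_posSemidef_choi, choi_replacer]
  exact Matrix.PosSemidef.one.kronecker hσ

theorem isChannel_replacer [Fintype b] {σ : Op b} (hσ : IsState σ) : IsChannel (replacer a σ) :=
  ⟨isCP_replacer hσ.1, fun X => by
    rw [replacer_apply, Matrix.trace_smul, hσ.2, smul_eq_mul, mul_one]⟩

theorem tensorMap_replacer [Fintype b] [DecidableEq b] (σ : Op a') (τ : Op b') :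
    tensorMap (replacer a σ) (replacer b τ) = replacer (a × b) (σ ⊗ₖ τ) :=
  linearMap_op_ext_kronecker fun X Y => by
    simp only [tensorMap_kronecker, replacer_apply, Matrix.trace_kronecker,
      Matrix.smul_kronecker, Matrix.kronecker_smul, smul_smul, mul_comm]

end Replacer

section PartialTranspose

variable {a b c d a' b' c' d' : Type}

@[simp]
theorem partialTranspose_apply (X : Op (a × b)) (p q : a × b) :
    partialTranspose a b X p q = X (p.1, q.2) (q.1, p.2) := rfl

theorem partialTranspose_kronecker (X : Op a) (Y : Op b) :
    partialTranspose a b (X ⊗ₖ Y) = X ⊗ₖ Yᵀ := rfl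

theorem partialTranspose_one [DecidableEq a] [DecidableEq b] :
    partialTranspose a b 1 = 1 := by
  rw [← Matrix.one_kronecker_one, partialTranspose_kronecker, Matrix.transpose_one]

theorem isTP_partialTranspose [Fintype a] [Fintype b] : IsTP (partialTranspose a b) :=
  fun _ => rfl

theorem trace_partialTranspose_mul_partialTranspose [Fintype a] [Fintype b] (X Y : Op (a × b)) :
    (partialTranspose a b X * partialTranspose a b Y).trace = (X * Y).trace := by
  simp only [Matrix.trace, Matrix.diag_apply, Matrix.mul_apply, partialTranspose_apply,
    Fintype.sum_prod_type]
  refine Finset.sum_congr rfl fun i _ => ?_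
  rw [Finset.sum_comm]
  conv_rhs => rw [Finset.sum_comm]
  exact Finset.sum_congr rfl fun i' _ => Finset.sum_comm

/-- The conjugate `T_{B'} ∘ N ∘ T_B` of a bipartite map by the partial transposes on Bob's
systems. -/
def bobTranspose : SuperOp (a × b) (a' × b') →ₗ[ℂ] SuperOp (a × b) (a' × b') where
  toFun N := partialTranspose a' b' ∘ₗ N ∘ₗ partialTranspose a b
  map_add' _ _ := rfl
  map_smul' _ _ := rfl

theorem bobTranspose_apply (N : SuperOp (a × b) (a' × b')) (X : Op (a × b)) :
    bobTranspose N X = partialTranspose a' b' (N (partialTranspose a b X)) := rfl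

theorem bobTranspose_comp (N : SuperOp (c × d) (a' × b')) (M : SuperOp (a × b) (c × d)) :
    bobTranspose (N ∘ₗ M) = bobTranspose N ∘ₗ bobTranspose M := rfl

theorem bobTranspose_replacer [Fintype a] [Fintype b] (σ : Op (a' × b')) :
    bobTranspose (replacer (a × b) σ) = replacer (a × b) (partialTranspose a' b' σ) := rfl

theorem choi_bobTranspose [DecidableEq a] [DecidableEq b] (N : SuperOp (a × b) (a' × b')) :
    choi (bobTranspose N) = (partialTranspose (a × a') (b × b')
      ((choi N).submatrix (Equiv.prodProdProdComm a a' b b')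
        (Equiv.prodProdProdComm a a' b b'))).submatrix
      (Equiv.prodProdProdComm a b a' b') (Equiv.prodProdProdComm a b a' b') := by
  ext ⟨⟨i, j⟩, k, l⟩ ⟨⟨i', j'⟩, k', l'⟩
  rw [choi_apply, bobTranspose_apply, ← mul_one (1 : ℂ), ← Matrix.single_kronecker_single,
    partialTranspose_kronecker, Matrix.transpose_single, Matrix.single_kronecker_single, mul_one]
  rfl

theorem trace_submatrix_equiv {m n R : Type*} [Fintype m] [Fintype n] [AddCommMonoid R]
    (A : Matrix n n R) (e : m ≃ n) : (A.submatrix e e).trace = A.trace :=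
  e.sum_comp fun i => A i i

theorem trace_choi_bobTranspose_mul [Fintype a] [DecidableEq a] [Fintype b] [DecidableEq b]
    [Fintype a'] [Fintype b'] (N M : SuperOp (a × b) (a' × b')) :
    (choi (bobTranspose N) * choi (bobTranspose M)).trace = (choi N * choi M).trace := by
  rw [choi_bobTranspose, choi_bobTranspose, Matrix.submatrix_mul_equiv, trace_submatrix_equiv,
    trace_partialTranspose_mul_partialTranspose, Matrix.submatrix_mul_equiv,
    trace_submatrix_equiv]

/-- The superoperator `X ↦ (G(Xᵀ))ᵀ`. -/
def transposeConj (G : SuperOp b b') : SuperOp b b' where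
  toFun X := (G Xᵀ)ᵀ
  map_add' X Y := by rw [Matrix.transpose_add, map_add, Matrix.transpose_add]
  map_smul' z X := by rw [Matrix.transpose_smul, map_smul, Matrix.transpose_smul, RingHom.id_apply]

theorem choi_transposeConj [DecidableEq b] (G : SuperOp b b') :
    choi (transposeConj G) = (choi G)ᵀ := by
  ext p q
  simp [transposeConj]

theorem IsCP.transposeConj [Fintype b] [DecidableEq b] [Finite b'] {G : SuperOp b b'}
    (hG : IsCP G) : IsCP (transposeConj G) := by
  rw [isCP_iff_posSemidef_choi, choi_transposeConj] at *
  exact hG.transpose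

variable [Fintype a] [DecidableEq a] [Fintype b] [DecidableEq b]

theorem bobTranspose_tensorMap (E : SuperOp a a') (G : SuperOp b b') :
    bobTranspose (tensorMap E G) = tensorMap E (transposeConj G) :=
  linearMap_op_ext_kronecker fun X Y => by
    simp only [bobTranspose_apply, partialTranspose_kronecker, tensorMap_kronecker]
    rfl

theorem IsCP.bobTranspose_tensorMap [Finite a'] [Finite b'] {E : SuperOp a a'} {G : SuperOp b b'}
    (hE : IsCP E) (hG : IsCP G) : IsCP (bobTranspose (tensorMap E G)) := by
  rw [Teleport.bobTranspose_tensorMap]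
  exact hE.tensor hG.transposeConj

variable [Fintype a'] [Fintype b']

theorem isCPPTP_tensorMap {E : SuperOp a a'} {G : SuperOp b b'} (hE : IsChannel E)
    (hG : IsChannel G) : IsCPPTP (tensorMap E G) :=
  ⟨⟨hE.1.tensor hG.1, hE.2.tensor hG.2⟩, hE.1.bobTranspose_tensorMap hG.1⟩

theorem isCPPTP_sum_comp [Fintype c] [DecidableEq c] [Fintype d] [DecidableEq d] {ι : Type*}
    [Fintype ι] {L : ι → SuperOp (c × d) (a' × b')} {M : ι → SuperOp (a × b) (c × d)}
    (hL : ∀ x, IsCPPTP (L x)) (hM : ∀ x, IsCP (M x)) (hM' : ∀ x, IsCP (bobTranspose (M x)))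
    (hM_sum : IsTP (∑ x, M x)) : IsCPPTP (∑ x, L x ∘ₗ M x) := by
  refine ⟨⟨IsCP.sum fun x _ => (hL x).1.1.comp (hM x), fun X => ?_⟩, ?_⟩
  · rw [← hM_sum X, LinearMap.sum_apply, LinearMap.sum_apply, Matrix.trace_sum, Matrix.trace_sum]
    exact Finset.sum_congr rfl fun x _ => (hL x).1.2 (M x X)
  · change IsCP (bobTranspose (∑ x, L x ∘ₗ M x))
    simp only [map_sum, bobTranspose_comp]
    have hL' (x : ι) : IsCP (bobTranspose (L x)) := (hL x).2
    exact IsCP.sum fun x _ => (hL' x).comp (hM' x)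

theorem IsLOCC.isCPPTP {L : SuperOp (a × b) (a' × b')} (hL : IsLOCC L) : IsCPPTP L := by
  induction hL with
  | localOps E G hE hG => exact isCPPTP_tensorMap hE hG
  | alice E L hE _ ih =>
    refine isCPPTP_sum_comp ih (fun x => (hE.1 x).tensor IsCP.id)
      (fun x => (hE.1 x).bobTranspose_tensorMap IsCP.id) ?_
    rw [← tensorMap_sum_left]
    exact hE.2.tensor IsTP.id
  | bob G L hG _ ih =>
    refine isCPPTP_sum_comp ih (fun x => IsCP.id.tensor (hG.1 x))
      (fun x => IsCP.id.bobTranspose_tensorMap (hG.1 x)) ?_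
    rw [← tensorMap_sum_right]
    exact IsTP.id.tensor hG.2

end PartialTranspose

section DiamondDist

variable {a b : Type} [Fintype a] [DecidableEq a] [Fintype b] [DecidableEq b]

theorem bddAbove_diamondDist {N M : SuperOp a b} (hN : IsChannel N) (hM : IsChannel M) :
    BddAbove {t : ℝ | ∃ (r : ℕ) (ρ : Op (Fin r × a)), IsState ρ ∧
      t = traceNorm (tensorMap (LinearMap.id : SuperOp (Fin r) (Fin r)) N ρ -
        tensorMap (LinearMap.id : SuperOp (Fin r) (Fin r)) M ρ)} := by
  refine ⟨2, ?_⟩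
  rintro t ⟨r, ρ, hρ, rfl⟩
  refine (traceNorm_sub_le (hN.1 r ρ hρ.1) (hM.1 r ρ hρ.1)).trans_eq ?_
  rw [hN.2.trace_tensorMap_id, hM.2.trace_tensorMap_id, hρ.2, Complex.one_re, one_add_one_eq_two]

theorem diamondDist_le_of_isCP_sub_smul {N M : SuperOp a b} (hN : IsChannel N) (hM : IsTP M)
    {p : ℝ} (hp : p ≤ 1) (h : IsCP (M - (p : ℂ) • N)) : diamondDist N M ≤ 2 * (1 - p) := by
  have hp' : 0 ≤ 1 - p := sub_nonneg.2 hp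
  refine Real.sSup_le ?_ (mul_nonneg zero_le_two hp')
  rintro t ⟨r, ρ, hρ, rfl⟩
  set ampl := tensorMapBilin (LinearMap.id : SuperOp (Fin r) (Fin r)) (b := a) (b' := b)
  have h_rest : ampl M - (p : ℂ) • ampl N = ampl (M - (p : ℂ) • N) := by rw [map_sub, map_smul]
  have h_diff : ampl N ρ - ampl M ρ =
      ((1 - p : ℝ) : ℂ) • ampl N ρ - ampl (M - (p : ℂ) • N) ρ := by
    rw [← h_rest, LinearMap.sub_apply, LinearMap.smul_apply]
    push_cast
    module
  have h_traceN : (ampl N ρ).trace = 1 := (hN.2.trace_tensorMap_id ρ).trans hρ.2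
  have h_traceM : (ampl M ρ).trace = 1 := (hM.trace_tensorMap_id ρ).trans hρ.2
  change traceNorm (ampl N ρ - ampl M ρ) ≤ _
  rw [h_diff]
  refine (traceNorm_sub_le ((hN.1 r ρ hρ.1).smul (Complex.zero_le_real.2 hp'))
    (h r ρ hρ.1)).trans_eq ?_
  change (_ • ampl N ρ).trace.re + (ampl (M - (p : ℂ) • N) ρ).trace.re = _
  rw [← h_rest, LinearMap.sub_apply, LinearMap.smul_apply, Matrix.trace_sub, Matrix.trace_smul,
    Matrix.trace_smul, h_traceN, h_traceM]
  simp only [smul_eq_mul, mul_one, Complex.sub_re, Complex.one_re, Complex.ofReal_re]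
  ring

theorem isState_entangledVec [Nonempty a] {r : Type} [Fintype r] (e : r ≃ a) :
    IsState ((Fintype.card a : ℂ)⁻¹ •
      Matrix.vecMulVec (entangledVec e) (star (entangledVec e))) := by
  refine ⟨(Matrix.posSemidef_vecMulVec_self_star _).smul (by positivity), ?_⟩
  rw [Matrix.trace_smul, Matrix.trace_vecMulVec, dotProduct_comm, entangledVec_dotProduct_self,
    smul_eq_mul, inv_mul_cancel₀ (Nat.cast_ne_zero.2 Fintype.card_ne_zero)]

theorem star_dotProduct_submatrix_mulVec {m n : Type*} [Fintype m] [Fintype n]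
    (A : Matrix n n ℂ) (e : m ≃ n) (v : n → ℂ) :
    star (v ∘ e) ⬝ᵥ A.submatrix e e *ᵥ (v ∘ e) = star v ⬝ᵥ A *ᵥ v := by
  rw [Matrix.submatrix_mulVec_equiv, Function.comp_assoc, Equiv.self_comp_symm, Function.comp_id]
  exact comp_equiv_dotProduct_comp_equiv (star v) (A *ᵥ v) e

theorem le_diamondDist [Nonempty a] {N M : SuperOp a b} (hN : IsChannel N) (hM : IsChannel M)
    {v : a × b → ℂ} (hv : star v ⬝ᵥ v = 1) :
    2 * ((Fintype.card a : ℂ)⁻¹ * (star v ⬝ᵥ (choi N - choi M) *ᵥ v)).re ≤ diamondDist N M := by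
  let e := (Fintype.equivFin a).symm
  have hρ := isState_entangledVec e
  set ρ := (Fintype.card a : ℂ)⁻¹ • Matrix.vecMulVec (entangledVec e) (star (entangledVec e))
  let e' := e.prodCongr (Equiv.refl b)
  have h_choi (N : SuperOp a b) : tensorMap (LinearMap.id : SuperOp (Fin _) (Fin _)) N ρ =
      (Fintype.card a : ℂ)⁻¹ • (choi N).submatrix e' e' := by
    rw [map_smul, tensorMap_id_entangledVec]
    rfl
  have hw : star (v ∘ e') ⬝ᵥ (v ∘ e') = 1 :=
    (comp_equiv_dotProduct_comp_equiv (star v) v e').trans hv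
  have h_le := le_traceNorm ((hN.1 _ ρ hρ.1).1.sub (hM.1 _ ρ hρ.1).1) hw
  refine le_trans (le_of_eq ?_) (h_le.trans
    (le_csSup (bddAbove_diamondDist hN hM) ⟨_, ρ, hρ, rfl⟩))
  rw [Matrix.trace_sub, hN.2.trace_tensorMap_id, hM.2.trace_tensorMap_id, sub_self,
    Complex.zero_re, sub_zero, h_choi, h_choi, ← smul_sub, Matrix.smul_mulVec, dotProduct_smul,
    smul_eq_mul, ← star_dotProduct_submatrix_mulVec _ e']
  rfl

end DiamondDist

section Swap

variable {d : ℕ}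

theorem permMatrix_apply {n R : Type*} [DecidableEq n] [Zero R] [One R] (σ : Equiv.Perm n)
    (i j : n) : σ.permMatrix R i j = if σ i = j then 1 else 0 := by
  simp [PEquiv.toMatrix_apply, Equiv.toPEquiv_apply, eq_comm]

theorem swapOp_apply (p q : Fin d × Fin d) : swapOp d p q = if p.swap = q then 1 else 0 := by
  simp only [swapOp, Matrix.single_kronecker_single, Matrix.sum_apply, mul_one,
    Matrix.single_apply]
  rw [Finset.sum_eq_single p.1, Finset.sum_eq_single p.2] <;> simp +contextual [Prod.ext_iff]

theorem swapOp_eq_permMatrix :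
    swapOp d = Equiv.Perm.permMatrix ℂ (Equiv.prodComm (Fin d) (Fin d)) := by
  ext p q
  rw [swapOp_apply, permMatrix_apply]
  rfl

theorem conjTranspose_swapOp : (swapOp d)ᴴ = swapOp d := by
  rw [swapOp_eq_permMatrix, Matrix.conjTranspose_permMatrix]
  rfl

theorem swapOp_mul_self : swapOp d * swapOp d = 1 := by
  rw [swapOp_eq_permMatrix, ← Matrix.permMatrix_mul]
  exact Matrix.permMatrix_one

theorem swapChannel_eq_conjMap : swapChannel d = conjMap (swapOp d) := rfl

theorem isChannel_swapChannel (d : ℕ) : IsChannel (swapChannel d) :=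
  isChannel_conjMap (by rw [conjTranspose_swapOp, swapOp_mul_self])

/-- The vector `∑_z |z⟩ ⊗ |swap z⟩`, whose projector is the Choi matrix of the swap channel. -/
def swapVec (d : ℕ) : (Fin d × Fin d) × (Fin d × Fin d) → ℂ :=
  entangledVec (Equiv.prodComm (Fin d) (Fin d))

theorem swapVec_dotProduct_self : star (swapVec d) ⬝ᵥ swapVec d = (d : ℂ) ^ 2 := by
  rw [swapVec, entangledVec_dotProduct_self]
  simp [sq]

theorem choi_swapChannel :
    choi (swapChannel d) = Matrix.vecMulVec (swapVec d) (star (swapVec d)) := by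
  have h : (fun p : (Fin d × Fin d) × (Fin d × Fin d) => swapOp d p.2 p.1) = swapVec d := by
    ext p
    simp only [swapOp_apply, swapVec, entangledVec, Equiv.coe_prodComm, Prod.swap_eq_iff_eq_swap,
      eq_comm (a := p.2)]
  rw [swapChannel_eq_conjMap, choi_conjMap, h]

theorem choi_bobTranspose_swapChannel : ∃ σ : Equiv.Perm ((Fin d × Fin d) × (Fin d × Fin d)),
    σ * σ = 1 ∧ choi (bobTranspose (swapChannel d)) = σ.permMatrix ℂ := by
  let σ : Equiv.Perm ((Fin d × Fin d) × (Fin d × Fin d)) :=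
    (Equiv.prodComm _ _).trans ((Equiv.prodComm _ _).prodCongr (Equiv.prodComm _ _))
  refine ⟨σ, rfl, ?_⟩
  ext ⟨⟨i, j⟩, k, l⟩ ⟨⟨i', j'⟩, k', l'⟩
  rw [choi_bobTranspose, choi_swapChannel, permMatrix_apply]
  simp only [swapVec, Matrix.submatrix_apply, Equiv.prodProdProdComm_apply,
    partialTranspose_apply, Matrix.vecMulVec_apply, star_entangledVec, entangledVec,
    Equiv.coe_prodComm, Prod.swap_prod_mk, Prod.mk.injEq, mul_ite, mul_one, mul_zero, ← ite_and,
    Equiv.trans_apply, Equiv.prodCongr_apply, Prod.map_apply, σ]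
  grind

theorem isCP_sq_smul_replacer_one_sub_swapChannel (d : ℕ) :
    IsCP ((d : ℂ) ^ 2 • replacer (Fin d × Fin d) 1 - swapChannel d) := by
  rw [isCP_iff_posSemidef_choi, map_sub, map_smul, choi_replacer, Matrix.one_kronecker_one,
    choi_swapChannel, ← swapVec_dotProduct_self]
  exact posSemidef_smul_one_sub_vecMulVec _

theorem isCP_replacer_one_add_smul_bobTranspose_swapChannel (d : ℕ) {ε : ℝ} (hε : ε * ε = 1) :
    IsCP (replacer (Fin d × Fin d) 1 + (ε : ℂ) • bobTranspose (swapChannel d)) := by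
  obtain ⟨σ, hσ, h_choi⟩ := choi_bobTranspose_swapChannel (d := d)
  rw [isCP_iff_posSemidef_choi, map_add, map_smul, choi_replacer, Matrix.one_kronecker_one, h_choi]
  exact posSemidef_one_add_smul_permMatrix hσ hε

theorem isCP_smul_bobTranspose_swapChannel_add_smul_replacer_one (d : ℕ) {α β : ℝ} (h : |α| ≤ β) :
    IsCP ((α : ℂ) • bobTranspose (swapChannel d) + (β : ℂ) • replacer (Fin d × Fin d) 1) := by
  obtain ⟨h_neg, h_pos⟩ := abs_le.1 h
  have h_add := (isCP_replacer_one_add_smul_bobTranspose_swapChannel d (mul_one 1)).smul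
    (Complex.zero_le_real.2 (by linarith : 0 ≤ (β + α) / 2))
  have h_sub := (isCP_replacer_one_add_smul_bobTranspose_swapChannel d
    (by norm_num : (-1 : ℝ) * -1 = 1)).smul
    (Complex.zero_le_real.2 (by linarith : 0 ≤ (β - α) / 2))
  convert h_add.add h_sub using 1
  push_cast
  module

end Swap

section SwapFidelity

variable {d : ℕ}

/-- The overlap `d⁻⁴ tr(C_N C_S)` of the Choi matrices of `N` and of the swap channel, that is
the entanglement fidelity between `N` and the swap channel. -/
def swapFidelity (d : ℕ) : SuperOp (Fin d × Fin d) (Fin d × Fin d) →ₗ[ℂ] ℂ :=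
  ((d : ℂ) ^ 4)⁻¹ • Matrix.traceLinearMap _ ℂ ℂ ∘ₗ
    LinearMap.mulRight ℂ (choi (swapChannel d)) ∘ₗ choi

theorem swapFidelity_apply (N : SuperOp (Fin d × Fin d) (Fin d × Fin d)) :
    swapFidelity d N = ((d : ℂ) ^ 4)⁻¹ * (choi N * choi (swapChannel d)).trace := rfl

theorem re_swapFidelity_eq_div (N : SuperOp (Fin d × Fin d) (Fin d × Fin d)) :
    (swapFidelity d N).re = (choi N * choi (swapChannel d)).trace.re / d ^ 4 := by
  have h_cast : ((d : ℂ) ^ 4)⁻¹ = (((d : ℝ) ^ 4)⁻¹ : ℝ) := by push_cast; rfl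
  rw [swapFidelity_apply, h_cast, Complex.re_ofReal_mul, inv_mul_eq_div]

theorem re_swapFidelity_le (hd : d ≠ 0) {N : SuperOp (Fin d × Fin d) (Fin d × Fin d)}
    (hN : IsCP N) : (swapFidelity d N).re ≤ (N 1).trace.re / d ^ 2 := by
  have h := dotProduct_mulVec_le_trace (isCP_iff_posSemidef_choi.1 hN) (swapVec d)
  have h_cast : (d : ℂ) ^ 2 = ((d ^ 2 : ℝ) : ℂ) := by push_cast; rfl
  rw [← trace_mul_vecMulVec, ← choi_swapChannel, swapVec_dotProduct_self, trace_choi, h_cast] at h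
  have h_re := (Complex.le_def.1 h).1
  rw [Complex.re_ofReal_mul] at h_re
  rw [re_swapFidelity_eq_div, div_le_div_iff₀ (by positivity) (by positivity)]
  nlinarith [sq_nonneg (d : ℝ)]

theorem abs_re_swapFidelity_le {N : SuperOp (Fin d × Fin d) (Fin d × Fin d)}
    (hN : IsCP (bobTranspose N)) : |(swapFidelity d N).re| ≤ (N 1).trace.re / d ^ 4 := by
  obtain ⟨σ, hσ, h_choi⟩ := choi_bobTranspose_swapChannel (d := d)
  have h_trace : (choi (bobTranspose N)).trace = (N 1).trace := by
    rw [trace_choi, bobTranspose_apply, partialTranspose_one]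
    exact isTP_partialTranspose _
  have h_le {ε : ℝ} (hε : ε * ε = 1) :
      ε * (choi N * choi (swapChannel d)).trace.re ≤ (N 1).trace.re := by
    have h := re_trace_mul_permMatrix_le (isCP_iff_posSemidef_choi.1 hN) hσ hε
    rwa [← h_choi, trace_choi_bobTranspose_mul, h_trace] at h
  rw [re_swapFidelity_eq_div, abs_div, abs_of_nonneg (by positivity : (0 : ℝ) ≤ d ^ 4)]
  gcongr
  exact abs_le'.2 ⟨by simpa using h_le (mul_one 1), by simpa using h_le (ε := -1) (by norm_num)⟩

theorem le_diamondDist_swapChannel (hd : d ≠ 0) {N : SuperOp (Fin d × Fin d) (Fin d × Fin d)}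
    (hN : IsChannel N) : 2 * (1 - (swapFidelity d N).re) ≤ diamondDist (swapChannel d) N := by
  have : NeZero d := ⟨hd⟩
  have hd' : (d : ℂ) ≠ 0 := Nat.cast_ne_zero.2 hd
  have hv : star ((d : ℂ)⁻¹ • swapVec d) ⬝ᵥ ((d : ℂ)⁻¹ • swapVec d) = 1 := by
    simp [swapVec_dotProduct_self, hd', sq]
  have h := le_diamondDist (isChannel_swapChannel d) hN hv
  have h_swap : swapFidelity d (swapChannel d) = 1 := by
    rw [swapFidelity_apply, choi_swapChannel, trace_mul_vecMulVec, Matrix.vecMulVec_mulVec,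
      swapVec_dotProduct_self]
    simp [swapVec_dotProduct_self, hd', ← pow_add]
  have h_sub : (Fintype.card (Fin d × Fin d) : ℂ)⁻¹ * (star ((d : ℂ)⁻¹ • swapVec d) ⬝ᵥ
      (choi (swapChannel d) - choi N) *ᵥ ((d : ℂ)⁻¹ • swapVec d)) = 1 - swapFidelity d N := by
    rw [← h_swap, ← map_sub (swapFidelity d), swapFidelity_apply, choi_swapChannel,
      trace_mul_vecMulVec, map_sub, choi_swapChannel, Matrix.mulVec_smul, dotProduct_smul,
      star_smul, smul_dotProduct, Fintype.card_prod, Fintype.card_fin, smul_eq_mul, smul_eq_mul,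
      star_inv₀, star_natCast]
    push_cast
    ring
  rwa [h_sub, Complex.sub_re, Complex.one_re] at h

end SwapFidelity

section Simulation

variable {a b r s a' b' : Type}

theorem attach_apply (ρ : Op (r × s)) (X : Op (a × b)) (p q : (a × r) × (b × s)) :
    attach ρ X p q = X (p.1.1, p.2.1) (q.1.1, q.2.1) * ρ (p.1.2, p.2.2) (q.1.2, q.2.2) := rfl

theorem attach_kronecker (Y : Op r) (Z : Op s) (X₁ : Op a) (X₂ : Op b) :
    attach (Y ⊗ₖ Z) (X₁ ⊗ₖ X₂) = (X₁ ⊗ₖ Y) ⊗ₖ (X₂ ⊗ₖ Z) := by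
  ext p q
  exact mul_mul_mul_comm ..

/-- The simulation by a fixed bipartite map, as a linear function of the resource. -/
def simulationLinear (P : SuperOp ((a × r) × (b × s)) (a' × b')) :
    Op (r × s) →ₗ[ℂ] SuperOp (a × b) (a' × b') where
  toFun := simulation P
  map_add' ρ σ := LinearMap.ext fun X =>
    (congrArg P (Matrix.ext fun _ _ => mul_add _ _ _)).trans (P.map_add (attach ρ X) (attach σ X))
  map_smul' z ρ := LinearMap.ext fun X =>
    (congrArg P (Matrix.ext fun _ _ => mul_left_comm _ z _)).trans (P.map_smul z (attach ρ X))

@[simp]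
theorem simulationLinear_apply (P : SuperOp ((a × r) × (b × s)) (a' × b')) (ρ : Op (r × s)) :
    simulationLinear P ρ = simulation P ρ := rfl

theorem bobTranspose_simulation (P : SuperOp ((a × r) × (b × s)) (a' × b')) (ρ : Op (r × s)) :
    bobTranspose (simulation P ρ) = simulation (bobTranspose P) (partialTranspose r s ρ) := rfl

theorem choi_attach [DecidableEq a] [DecidableEq b] (ρ : Op (r × s)) :
    choi (attach ρ : SuperOp (a × b) _) =
      (Matrix.vecMulVec (entangledVec (Equiv.refl (a × b)))
          (star (entangledVec (Equiv.refl (a × b)))) ⊗ₖ ρ).submatrix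
        (fun p => ((p.1, (p.2.1.1, p.2.2.1)), (p.2.1.2, p.2.2.2)))
        (fun p => ((p.1, (p.2.1.1, p.2.2.1)), (p.2.1.2, p.2.2.2))) := by
  ext p q
  rw [star_entangledVec]
  by_cases hp : p.1 = (p.2.1.1, p.2.2.1) <;> by_cases hq : q.1 = (q.2.1.1, q.2.2.1) <;>
    simp [attach_apply, entangledVec, Matrix.vecMulVec_apply, hp, hq]

variable [Fintype a] [Fintype b]

theorem trace_attach [Fintype r] [Fintype s] (ρ : Op (r × s)) (X : Op (a × b)) :
    (attach ρ X).trace = X.trace * ρ.trace := by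
  rw [← Matrix.trace_kronecker, ← trace_submatrix_equiv _ (Equiv.prodProdProdComm a r b s)]
  rfl

theorem trace_simulation [Fintype r] [Fintype s] [Fintype a'] [Fintype b']
    {P : SuperOp ((a × r) × (b × s)) (a' × b')} (hP : IsTP P) (ρ : Op (r × s)) (X : Op (a × b)) :
    (simulation P ρ X).trace = X.trace * ρ.trace :=
  (hP _).trans (trace_attach ρ X)

variable [DecidableEq a] [DecidableEq b]

theorem isCP_attach [Finite r] [Finite s] {ρ : Op (r × s)} (hρ : ρ.PosSemidef) :
    IsCP (attach ρ : SuperOp (a × b) _) := by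
  rw [isCP_iff_posSemidef_choi, choi_attach]
  exact ((Matrix.posSemidef_vecMulVec_self_star _).kronecker hρ).submatrix _

theorem simulation_comp_tensorMap {r' s' : Type} [Fintype r'] [DecidableEq r']
    [Fintype s'] [DecidableEq s'] (L : SuperOp ((a × r) × (b × s)) (a' × b'))
    (E : SuperOp r' r) (G : SuperOp s' s) (ρ : Op (r' × s')) :
    simulation (L ∘ₗ tensorMap (tensorMap (LinearMap.id : SuperOp a a) E)
      (tensorMap (LinearMap.id : SuperOp b b) G)) ρ = simulation L (tensorMap E G ρ) := by
  refine DFunLike.congr_fun (f := simulationLinear _) (g := simulationLinear L ∘ₗ tensorMap E G)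
    (linearMap_op_ext_kronecker fun Y Z => linearMap_op_ext_kronecker fun X₁ X₂ => ?_) ρ
  simp only [LinearMap.comp_apply, simulationLinear_apply, simulation, tensorMap_kronecker,
    attach_kronecker, LinearMap.id_apply]

variable [Fintype r] [DecidableEq r] [Fintype s] [DecidableEq s]

theorem IsCP.simulation [Finite a'] [Finite b'] {P : SuperOp ((a × r) × (b × s)) (a' × b')}
    (hP : IsCP P) {ρ : Op (r × s)} (hρ : ρ.PosSemidef) : IsCP (simulation P ρ) :=
  hP.comp (isCP_attach hρ)

theorem IsChannel.simulation [Fintype a'] [Fintype b']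
    {P : SuperOp ((a × r) × (b × s)) (a' × b')} (hP : IsChannel P) {ρ : Op (r × s)}
    (hρ : IsState ρ) : IsChannel (simulation P ρ) :=
  ⟨hP.1.simulation hρ.1, fun X => by rw [trace_simulation hP.2, hρ.2, mul_one]⟩

theorem IsLOCC.comp_tensorMap {c c' : Type} [Fintype c] [DecidableEq c] [Fintype c']
    [DecidableEq c'] [Fintype a'] [Fintype b'] {L : SuperOp (c × c') (a' × b')} (hL : IsLOCC L)
    {E : SuperOp a c} {G : SuperOp b c'} (hE : IsChannel E) (hG : IsChannel G) :
    IsLOCC (L ∘ₗ tensorMap E G) := by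
  have h_bob := IsLOCC.bob (a := c) (fun _ : Fin 1 => G) (fun _ => L)
    ⟨fun _ => hG.1, by simpa using hG.2⟩ (fun _ => hL)
  have h_alice := IsLOCC.alice (b := b) (fun _ : Fin 1 => E) _
    ⟨fun _ => hE.1, by simpa using hE.2⟩ (fun _ => h_bob)
  convert h_alice using 1
  simp only [Finset.univ_unique, Finset.sum_singleton]
  rw [LinearMap.comp_assoc, ← tensorMap_comp]
  rfl

end Simulation

section Isotropic

variable {D : ℕ}

theorem maxEntangled_eq_smul_vecMulVec (D : ℕ) :
    maxEntangled D = (D : ℂ)⁻¹ • Matrix.vecMulVec (entangledVec (Equiv.refl (Fin D)))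
      (star (entangledVec (Equiv.refl (Fin D)))) := by
  rw [maxEntangled, one_div]
  congr 1
  ext p q
  by_cases hp : p.1 = p.2 <;> by_cases hq : q.1 = q.2 <;>
    simp [star_entangledVec, Matrix.sum_apply, Matrix.single_apply, Matrix.vecMulVec_apply,
      entangledVec, ite_and, eq_comm (a := p.2), eq_comm (a := q.2), hp, hq]

theorem posSemidef_maxEntangled (D : ℕ) : (maxEntangled D).PosSemidef := by
  rw [maxEntangled_eq_smul_vecMulVec]
  exact (Matrix.posSemidef_vecMulVec_self_star _).smul (inv_nonneg.2 (Nat.cast_nonneg D))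

theorem trace_maxEntangled (hD : D ≠ 0) : (maxEntangled D).trace = 1 := by
  rw [maxEntangled_eq_smul_vecMulVec, Matrix.trace_smul, Matrix.trace_vecMulVec, dotProduct_comm,
    entangledVec_dotProduct_self, Fintype.card_fin, smul_eq_mul,
    inv_mul_cancel₀ (Nat.cast_ne_zero.2 hD)]

theorem maxEntangled_mul_self (hD : D ≠ 0) : maxEntangled D * maxEntangled D = maxEntangled D := by
  rw [maxEntangled_eq_smul_vecMulVec, smul_mul_smul_comm, Matrix.vecMulVec_mul_vecMulVec,
    entangledVec_dotProduct_self, Fintype.card_fin, Matrix.vecMulVec_smul,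
    smul_smul, inv_mul_cancel_right₀ (Nat.cast_ne_zero.2 hD)]

theorem posSemidef_one_sub_maxEntangled (hD : D ≠ 0) : (1 - maxEntangled D).PosSemidef := by
  have h := (posSemidef_smul_one_sub_vecMulVec (entangledVec (Equiv.refl (Fin D)))).smul
    (inv_nonneg.2 (Nat.cast_nonneg (α := ℂ) D))
  rwa [entangledVec_dotProduct_self, Fintype.card_fin, smul_sub,
    inv_smul_smul₀ (Nat.cast_ne_zero.2 hD), ← maxEntangled_eq_smul_vecMulVec] at h

theorem partialTranspose_maxEntangled (D : ℕ) :
    partialTranspose (Fin D) (Fin D) (maxEntangled D) = (D : ℂ)⁻¹ • swapOp D := by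
  ext p q
  rw [maxEntangled_eq_smul_vecMulVec, star_entangledVec, partialTranspose_apply, Matrix.smul_apply,
    Matrix.smul_apply, swapOp_apply]
  by_cases h₁ : p.1 = q.2 <;> by_cases h₂ : p.2 = q.1 <;>
    simp [Matrix.vecMulVec_apply, entangledVec, Prod.ext_iff, h₁, h₂, eq_comm (a := q.1)]

theorem trace_one_fin_prod_fin (D : ℕ) : (1 : Op (Fin D × Fin D)).trace = (D : ℂ) ^ 2 := by
  rw [Matrix.trace_one, Fintype.card_prod, Fintype.card_fin, Nat.cast_mul, sq]

theorem trace_isotropicState (hD : 2 ≤ D) (F : ℝ) : (isotropicState D F).trace = 1 := by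
  have h_ne : (D : ℂ) ^ 2 - 1 ≠ 0 :=
    sub_ne_zero.2 (by exact_mod_cast (Nat.one_lt_pow two_ne_zero (by omega) : 1 < D ^ 2).ne')
  rw [isotropicState, Matrix.trace_add, Matrix.trace_smul, Matrix.trace_smul, Matrix.trace_sub,
    trace_maxEntangled (by omega), trace_one_fin_prod_fin, smul_eq_mul, smul_eq_mul, mul_one,
    div_mul_cancel₀ _ h_ne, add_sub_cancel]

theorem isState_isotropicState (hD : 2 ≤ D) {F : ℝ} (hF₀ : 0 ≤ F) (hF₁ : F ≤ 1) :
    IsState (isotropicState D F) := by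
  have h_pos : (0 : ℝ) < D ^ 2 - 1 := by
    have : (2 : ℝ) ≤ D := mod_cast hD
    nlinarith
  have h_coeff : (0 : ℂ) ≤ (1 - F : ℂ) / ((D : ℂ) ^ 2 - 1) := by
    exact_mod_cast div_nonneg (sub_nonneg.2 hF₁) h_pos.le
  exact ⟨((posSemidef_maxEntangled D).smul (Complex.zero_le_real.2 hF₀)).add
    ((posSemidef_one_sub_maxEntangled (by omega)).smul h_coeff), trace_isotropicState hD F⟩

theorem trace_isotropicState_mul_maxEntangled (hD : D ≠ 0) (F : ℝ) :
    (isotropicState D F * maxEntangled D).trace = F := by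
  rw [isotropicState, add_mul, smul_mul_assoc, smul_mul_assoc, sub_mul, one_mul,
    maxEntangled_mul_self hD, sub_self, smul_zero, add_zero, Matrix.trace_smul,
    trace_maxEntangled hD, smul_eq_mul, mul_one]

theorem isotropicState_eq_add_sub (hD : 2 ≤ D) (F : ℝ) :
    isotropicState D F =
      (((F * D + 1) / (2 * D * (D + 1)) : ℝ) : ℂ) • (1 + (D : ℂ) • maxEntangled D) +
      (((1 - F * D) / (2 * D * (D - 1)) : ℝ) : ℂ) • (1 - (D : ℂ) • maxEntangled D) := by
  have h₀ : (D : ℂ) ≠ 0 := by exact_mod_cast (by omega : D ≠ 0)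
  have h₁ : (D : ℂ) - 1 ≠ 0 := sub_ne_zero.2 (by exact_mod_cast (by omega : D ≠ 1))
  have h₂ : (D : ℂ) + 1 ≠ 0 := by exact_mod_cast D.succ_ne_zero
  rw [isotropicState, show (D : ℂ) ^ 2 - 1 = (D - 1) * (D + 1) by ring]
  push_cast
  match_scalars <;> field_simp <;> ring

theorem isotropicState_eq_add_smul_maxEntangled (hD : 2 ≤ D) (F : ℝ) :
    isotropicState D F =
      (((1 - F) / ((D - 1) * (D + 1)) : ℝ) : ℂ) • (1 + (D : ℂ) • maxEntangled D) +
      (((F * D - 1) / (D - 1) : ℝ) : ℂ) • maxEntangled D := by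
  have h₁ : (D : ℂ) - 1 ≠ 0 := sub_ne_zero.2 (by exact_mod_cast (by omega : D ≠ 1))
  have h₂ : (D : ℂ) + 1 ≠ 0 := by exact_mod_cast D.succ_ne_zero
  rw [isotropicState, show (D : ℂ) ^ 2 - 1 = (D - 1) * (D + 1) by ring]
  push_cast
  match_scalars
  · field_simp
    ring
  · field_simp

end Isotropic

section FidelityBound

variable {d D : ℕ}

theorem re_swapFidelity_simulation_le (hd : d ≠ 0) {r s : Type} [Fintype r] [DecidableEq r]
    [Fintype s] [DecidableEq s] {P : SuperOp ((Fin d × r) × (Fin d × s)) (Fin d × Fin d)}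
    (hP : IsChannel P) {ρ : Op (r × s)} (hρ : ρ.PosSemidef) :
    (swapFidelity d (simulation P ρ)).re ≤ ρ.trace.re := by
  have h := re_swapFidelity_le hd (hP.1.simulation hρ)
  have h_ne : (d : ℝ) ^ 2 ≠ 0 := pow_ne_zero 2 (Nat.cast_ne_zero.2 hd)
  rwa [trace_simulation hP.2, trace_one_fin_prod_fin, ← Complex.ofReal_natCast,
    ← Complex.ofReal_pow, Complex.re_ofReal_mul, mul_div_cancel_left₀ _ h_ne] at h

theorem abs_re_swapFidelity_simulation_le {r s : Type} [Fintype r] [DecidableEq r]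
    [Fintype s] [DecidableEq s] {P : SuperOp ((Fin d × r) × (Fin d × s)) (Fin d × Fin d)}
    (hP : IsCPPTP P) {ρ : Op (r × s)} (hρ : (partialTranspose r s ρ).PosSemidef) :
    |(swapFidelity d (simulation P ρ)).re| ≤ ρ.trace.re / d ^ 2 := by
  have hP' : IsCP (bobTranspose P) := hP.2
  have h := abs_re_swapFidelity_le (d := d) (N := simulation P ρ) (by
    rw [bobTranspose_simulation]
    exact hP'.simulation hρ)
  rw [trace_simulation hP.1.2, trace_one_fin_prod_fin, ← Complex.ofReal_natCast,
    ← Complex.ofReal_pow, Complex.re_ofReal_mul] at h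
  refine h.trans_eq ?_
  rcases eq_or_ne d 0 with rfl | hd
  · simp
  · field_simp

theorem abs_re_swapFidelity_simulation_one_add_smul_maxEntangled_le (hD : D ≠ 0)
    {P : SuperOp ((Fin d × Fin D) × (Fin d × Fin D)) (Fin d × Fin d)} (hP : IsCPPTP P)
    {ε : ℝ} (hε : ε * ε = 1) :
    |(swapFidelity d (simulation P (1 + (ε * D : ℂ) • maxEntangled D))).re| ≤
      (D ^ 2 + ε * D) / d ^ 2 := by
  have h_pt : partialTranspose (Fin D) (Fin D) (1 + (ε * D : ℂ) • maxEntangled D) =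
      1 + (ε : ℂ) • swapOp D := by
    rw [map_add, map_smul, partialTranspose_one, partialTranspose_maxEntangled, smul_smul,
      mul_inv_cancel_right₀ (Nat.cast_ne_zero.2 hD)]
  have h := abs_re_swapFidelity_simulation_le hP (ρ := 1 + (ε * D : ℂ) • maxEntangled D) (by
    rw [h_pt, swapOp_eq_permMatrix]
    exact posSemidef_one_add_smul_permMatrix rfl hε)
  rw [Matrix.trace_add, Matrix.trace_smul, trace_maxEntangled hD, trace_one_fin_prod_fin,
    smul_eq_mul, mul_one] at h
  exact_mod_cast h

theorem re_swapFidelity_simulation_isotropicState_le_max (hD : 2 ≤ D)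
    {P : SuperOp ((Fin d × Fin D) × (Fin d × Fin D)) (Fin d × Fin d)} (hP : IsCPPTP P)
    {F : ℝ} (hF₀ : 0 ≤ F) :
    (swapFidelity d (simulation P (isotropicState D F))).re ≤ max 1 (F * D) / d ^ 2 := by
  have hD₀ : D ≠ 0 := by omega
  have hD₂ : (2 : ℝ) ≤ D := mod_cast hD
  have h_plus := abs_re_swapFidelity_simulation_one_add_smul_maxEntangled_le hD₀ hP (mul_one 1)
  have h_minus := abs_re_swapFidelity_simulation_one_add_smul_maxEntangled_le hD₀ hP
    (by norm_num : (-1 : ℝ) * -1 = 1)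
  simp only [Complex.ofReal_one, Complex.ofReal_neg, one_mul, neg_mul, neg_smul,
    ← sub_eq_add_neg] at h_plus h_minus
  rw [← simulationLinear_apply, isotropicState_eq_add_sub hD, map_add, map_smul, map_smul, map_add,
    map_smul, map_smul, smul_eq_mul, smul_eq_mul, Complex.add_re, Complex.re_ofReal_mul,
    Complex.re_ofReal_mul]
  have h_mul_le : ∀ {u z m : ℝ}, |z| ≤ m → u * z ≤ |u| * m := fun {u z m} h =>
    (le_abs_self _).trans ((abs_mul u z).trans_le (mul_le_mul_of_nonneg_left h (abs_nonneg u)))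
  calc _ ≤ |(F * D + 1) / (2 * D * (D + 1))| * ((D ^ 2 + D) / d ^ 2) +
        |(1 - F * D) / (2 * D * (D - 1))| * ((D ^ 2 - D) / d ^ 2) :=
        add_le_add (h_mul_le h_plus) (h_mul_le h_minus)
    _ = (1 + F * D + |1 - F * D|) / 2 / d ^ 2 := by
        rw [abs_div, abs_div, abs_of_nonneg (by positivity : 0 ≤ F * D + 1),
          abs_of_pos (by positivity : (0 : ℝ) < 2 * D * (D + 1)),
          abs_of_pos (by nlinarith : (0 : ℝ) < 2 * D * (D - 1))]
        have : (D : ℝ) - 1 ≠ 0 := by linarith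
        field_simp
        ring
    _ = max 1 (F * D) / d ^ 2 := by
        rw [sup_eq_half_smul_add_add_abs_sub' ℝ, smul_eq_mul, abs_sub_comm, div_eq_inv_mul _ 2]

theorem re_swapFidelity_simulation_isotropicState_le (hd : d ≠ 0) (hD : 2 ≤ D)
    {P : SuperOp ((Fin d × Fin D) × (Fin d × Fin D)) (Fin d × Fin d)} (hP : IsCPPTP P)
    {F : ℝ} (hF : 1 / D ≤ F) (hF₁ : F ≤ 1) :
    (swapFidelity d (simulation P (isotropicState D F))).re ≤
      1 - (1 - 1 / d ^ 2) * (1 - F) / (1 - 1 / D) := by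
  have hD₀ : D ≠ 0 := by omega
  have hD₂ : (2 : ℝ) ≤ D := mod_cast hD
  have hD_sub : (0 : ℝ) < D - 1 := by linarith
  have h_plus := (le_abs_self _).trans
    (abs_re_swapFidelity_simulation_one_add_smul_maxEntangled_le hD₀ hP (mul_one 1))
  have h_entangled := re_swapFidelity_simulation_le hd hP.1 (posSemidef_maxEntangled D)
  rw [trace_maxEntangled hD₀, Complex.one_re] at h_entangled
  simp only [Complex.ofReal_one, one_mul] at h_plus
  rw [← simulationLinear_apply, isotropicState_eq_add_smul_maxEntangled hD, map_add, map_smul,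
    map_smul, map_add, map_smul, map_smul, smul_eq_mul, smul_eq_mul, Complex.add_re,
    Complex.re_ofReal_mul, Complex.re_ofReal_mul]
  have hF_mul : 1 ≤ F * D := by rwa [div_le_iff₀ (by linarith)] at hF
  calc _ ≤ (1 - F) / ((D - 1) * (D + 1)) * ((D ^ 2 + D) / d ^ 2) + (F * D - 1) / (D - 1) * 1 :=
        add_le_add
          (mul_le_mul_of_nonneg_left h_plus (div_nonneg (sub_nonneg.2 hF₁) (by positivity)))
          (mul_le_mul_of_nonneg_left h_entangled (div_nonneg (sub_nonneg.2 hF_mul) hD_sub.le))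
    _ = _ := by
        rw [show 1 - 1 / (D : ℝ) = (D - 1) / D by field_simp]
        field_simp
        ring

end FidelityBound

section UnitaryBasis

/-- An orthogonal basis of the operators on a finite-dimensional space consisting of unitaries. The
orthogonality is stated in its dual form, as the completeness relation of the matrix entries. -/
structure IsUnitaryOperatorBasis {n ι : Type*} [Fintype n] [DecidableEq n] [Fintype ι]
    (W : ι → Matrix n n ℂ) : Prop where
  conjTranspose_mul_self (w : ι) : (W w)ᴴ * W w = 1
  sum_star_mul (x i x' i' : n) :
    ∑ w, star (W w x i) * W w x' i' = if x = x' ∧ i = i' then (Fintype.card n : ℂ) else 0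

theorem IsUnitaryOperatorBasis.comp_equiv {n ι κ : Type*} [Fintype n] [DecidableEq n] [Fintype ι]
    [Fintype κ] {W : ι → Matrix n n ℂ} (hW : IsUnitaryOperatorBasis W) (e : κ ≃ ι) :
    IsUnitaryOperatorBasis (W ∘ e) where
  conjTranspose_mul_self w := hW.conjTranspose_mul_self (e w)
  sum_star_mul x i x' i' := by
    rw [← hW.sum_star_mul, ← e.sum_comp]
    rfl

/-- The Weyl operators of a finite abelian group: multiplication by a character followed by a
translation. -/
def weylOp {G : Type*} [AddCommGroup G] [DecidableEq G] (w : G × AddChar G ℂ) : Matrix G G ℂ :=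
  Matrix.of fun x i => if x = i + w.1 then w.2 i else 0

theorem isUnitaryOperatorBasis_weylOp {G : Type*} [AddCommGroup G] [Fintype G] [DecidableEq G] :
    IsUnitaryOperatorBasis (weylOp (G := G)) where
  conjTranspose_mul_self w := by
    ext i j
    by_cases h : i = j
    · subst h
      simp [weylOp, Matrix.mul_apply, Complex.conj_mul']
    · simp [weylOp, Matrix.mul_apply, h, Ne.symm h]
  sum_star_mul x i x' i' := by
    have h_characters : ∑ ψ : AddChar G ℂ, star (ψ i) * ψ i' =
        if i = i' then (Fintype.card G : ℂ) else 0 := by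
      rw [← if_congr (sub_eq_zero.trans eq_comm) rfl rfl, ← AddChar.sum_apply_eq_ite]
      refine Finset.sum_congr rfl fun ψ _ => ?_
      rw [sub_eq_neg_add, AddChar.map_add_eq_mul, AddChar.map_neg_eq_conj]
      rfl
    have h_translation (g : G) : ∑ ψ : AddChar G ℂ, star (weylOp (g, ψ) x i) *
        weylOp (g, ψ) x' i' =
          if g = x - i then (if x = x' ∧ i = i' then (Fintype.card G : ℂ) else 0) else 0 := by
      have h_term (ψ : AddChar G ℂ) : star (weylOp (g, ψ) x i) * weylOp (g, ψ) x' i' =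
          if x = i + g ∧ x' = i' + g then star (ψ i) * ψ i' else 0 := by
        simp only [weylOp, Matrix.of_apply]
        split_ifs <;> simp_all
      rw [Finset.sum_congr rfl fun ψ _ => h_term ψ, Finset.sum_ite_irrel, h_characters,
        Finset.sum_const_zero]
      grind
    simp only [Fintype.sum_prod_type, h_translation, Finset.sum_ite_eq', Finset.mem_univ, if_true]

theorem exists_isUnitaryOperatorBasis (d : ℕ) :
    ∃ W : Fin (d * d) → Op (Fin d), IsUnitaryOperatorBasis W := by
  rcases eq_or_ne d 0 with rfl | hd
  · exact ⟨0, ⟨fun _ => Subsingleton.elim _ _, fun x => x.elim0⟩⟩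
  have : NeZero d := ⟨hd⟩
  have h_card : Fintype.card (Fin d × AddChar (Fin d) ℂ) = d * d := by
    rw [Fintype.card_prod, AddChar.card_eq, Fintype.card_fin]
  exact ⟨_, isUnitaryOperatorBasis_weylOp.comp_equiv (Fintype.equivFinOfCardEq h_card).symm⟩

end UnitaryBasis

section AttachKraus

variable {a b r s : Type} [DecidableEq a] [DecidableEq b]

/-- The Kraus operator that appends the pure resource with vector `ψ`. -/
def attachKraus (ψ : r × s → ℂ) : Matrix ((a × r) × (b × s)) (a × b) ℂ :=
  Matrix.of fun p q => if q = (p.1.1, p.2.1) then ψ (p.1.2, p.2.2) else 0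

variable [Fintype a] [Fintype b]

theorem attach_vecMulVec (ψ : r × s → ℂ) :
    (attach (Matrix.vecMulVec ψ (star ψ)) : SuperOp (a × b) _) = conjMap (attachKraus ψ) := by
  ext1 X
  ext p q
  simp only [attach_apply, conjMap_apply, attachKraus, Matrix.mul_apply, Matrix.of_apply,
    Matrix.conjTranspose_apply, ite_mul, zero_mul, Finset.sum_ite_eq', Finset.mem_univ, if_true,
    apply_ite star, star_zero, mul_ite, mul_zero, Matrix.vecMulVec_apply, Pi.star_apply]
  ring

theorem mul_attachKraus_apply [Fintype r] [Fintype s] {c : Type}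
    (K : Matrix c ((a × r) × (b × s)) ℂ) (ψ : r × s → ℂ) (k : c) (x : a) (y : b) :
    (K * (attachKraus ψ : Matrix _ (a × b) ℂ)) k (x, y) =
      ∑ p, ∑ q, K k ((x, p), (y, q)) * ψ (p, q) := by
  simp only [Matrix.mul_apply, attachKraus, Matrix.of_apply, Fintype.sum_prod_type, Prod.mk.injEq,
    ite_and, mul_ite, mul_zero]
  rw [Finset.sum_eq_single x (fun x' _ hx => by simp [hx.symm]) (by simp)]
  refine Finset.sum_congr rfl fun p _ => ?_
  rw [Finset.sum_eq_single y (fun y' _ hy => by simp [hy.symm]) (by simp)]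
  simp

end AttachKraus

section Teleportation

variable {d : ℕ}

theorem inv_sqrt_mul_inv_sqrt (d : ℕ) : (√d : ℂ)⁻¹ * (√d : ℂ)⁻¹ = (d : ℂ)⁻¹ := by
  rw [← mul_inv, ← Complex.ofReal_mul, Real.mul_self_sqrt d.cast_nonneg, Complex.ofReal_natCast]

/-- The Kraus operator of the outcome `V` of a Bell measurement of the first two of three systems:
the projection onto the maximally entangled vector twisted by `V`. -/
def bellKraus (V : Op (Fin d)) : Matrix (Fin d) (Fin d × (Fin d × Fin d)) ℂ :=
  Matrix.of fun k p => if k = p.2.2 then (√d : ℂ)⁻¹ * star (V p.1 p.2.1) else 0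

theorem mul_bellKraus_apply {m : Type*} (U : Matrix m (Fin d) ℂ) (V : Op (Fin d)) (k : m)
    (p : Fin d × (Fin d × Fin d)) :
    (U * bellKraus V : Matrix m _ ℂ) k p = (√d : ℂ)⁻¹ * star (V p.1 p.2.1) * U k p.2.2 := by
  simp only [Matrix.mul_apply, bellKraus, Matrix.of_apply, mul_ite, mul_zero, Finset.sum_ite_eq',
    Finset.mem_univ, if_true]
  exact mul_comm ..

theorem sum_conjTranspose_mul_bellKraus {ι : Type*} [Fintype ι] {W : ι → Op (Fin d)} (hd : d ≠ 0)
    (hW : IsUnitaryOperatorBasis W) : ∑ w, (bellKraus (W w))ᴴ * bellKraus (W w) = 1 := by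
  have h_entry (w : ι) (p q : Fin d × (Fin d × Fin d)) :
      ((bellKraus (W w))ᴴ * bellKraus (W w) : Matrix _ _ ℂ) p q =
        if p.2.2 = q.2.2 then (d : ℂ)⁻¹ * (star (W w q.1 q.2.1) * W w p.1 p.2.1) else 0 := by
    rw [← inv_sqrt_mul_inv_sqrt, mul_bellKraus_apply, Matrix.conjTranspose_apply, bellKraus,
      Matrix.of_apply, apply_ite star, star_zero, mul_ite, mul_zero]
    rw [star_mul', star_star, star_inv₀, Complex.star_def, Complex.conj_ofReal]
    exact if_congr eq_comm (by ring) rfl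
  ext p q
  rw [Matrix.sum_apply, Finset.sum_congr rfl fun w _ => h_entry w p q, Finset.sum_ite_irrel,
    ← Finset.mul_sum, hW.sum_star_mul, Fintype.card_fin, Matrix.one_apply, Finset.sum_const_zero]
  have hd' : (d : ℂ) ≠ 0 := Nat.cast_ne_zero.2 hd
  grind

/-- Bob measures his input together with the second half of his resource and corrects the first
half according to Alice's outcome `U`. -/
def bobKraus (U V : Op (Fin d)) : Matrix (Fin d) (Fin d × (Fin d × Fin d)) ℂ :=
  (U * bellKraus V).submatrix id (Prod.map id Prod.swap)

theorem sum_conjTranspose_mul_bobKraus {ι : Type*} [Fintype ι] {W : ι → Op (Fin d)} (hd : d ≠ 0)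
    (hW : IsUnitaryOperatorBasis W) {U : Op (Fin d)} (hU : Uᴴ * U = 1) :
    ∑ w, (bobKraus U (W w))ᴴ * bobKraus U (W w) = 1 := by
  have h_mul (V : Op (Fin d)) : (bobKraus U V)ᴴ * bobKraus U V =
      ((bellKraus V)ᴴ * bellKraus V).submatrix (Prod.map id Prod.swap) (Prod.map id Prod.swap) := by
    rw [bobKraus, Matrix.conjTranspose_submatrix, ← Matrix.submatrix_mul _ _ _ id _
      Function.bijective_id, Matrix.conjTranspose_mul, Matrix.mul_assoc, ← Matrix.mul_assoc Uᴴ, hU,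
      Matrix.one_mul]
  ext p q
  simp only [h_mul, Matrix.sum_apply, Matrix.submatrix_apply]
  rw [← Matrix.sum_apply, sum_conjTranspose_mul_bellKraus hd hW]
  exact congr_fun₂ (Matrix.submatrix_one _ (Function.injective_id.prodMap Prod.swap_injective)) p q

/-- Bidirectional teleportation through a resource of two pairs of `d`-dimensional systems: Alice
announces a Bell measurement of her input and her first half, then Bob one of his input and his
second half, and each of them corrects the remaining half by the unitary the other announced. -/
def teleportation {n : ℕ} (W : Fin n → Op (Fin d)) :
    SuperOp ((Fin d × (Fin d × Fin d)) × (Fin d × (Fin d × Fin d))) (Fin d × Fin d) :=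
  ∑ u, (∑ v, tensorMap (conjMap (W v)) LinearMap.id ∘ₗ
    tensorMap LinearMap.id (conjMap (bobKraus (W u) (W v)))) ∘ₗ
      tensorMap (conjMap (bellKraus (W u))) LinearMap.id

theorem isLOCC_teleportation (hd : d ≠ 0) {n : ℕ} {W : Fin n → Op (Fin d)}
    (hW : IsUnitaryOperatorBasis W) : IsLOCC (teleportation W) :=
  .alice _ _ (isInstrument_conjMap (sum_conjTranspose_mul_bellKraus hd hW)) fun u =>
    .bob _ _ (isInstrument_conjMap
      (sum_conjTranspose_mul_bobKraus hd hW (hW.conjTranspose_mul_self u))) fun v =>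
        .localOps _ _ (isChannel_conjMap (hW.conjTranspose_mul_self v)) ⟨IsCP.id, IsTP.id⟩

/-- The Kraus operators of bidirectional teleportation. -/
def teleportationKraus (U V : Op (Fin d)) :
    Matrix (Fin d × Fin d) ((Fin d × (Fin d × Fin d)) × (Fin d × (Fin d × Fin d))) ℂ :=
  (V * bellKraus U) ⊗ₖ bobKraus U V

theorem teleportation_eq_sum_conjMap {n : ℕ} (W : Fin n → Op (Fin d)) :
    teleportation W = ∑ x : Fin n × Fin n, conjMap (teleportationKraus (W x.1) (W x.2)) := by
  have h_sum_comp (M : Fin n → SuperOp (Fin d × (Fin d × (Fin d × Fin d))) (Fin d × Fin d))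
      (N : SuperOp ((Fin d × (Fin d × Fin d)) × (Fin d × (Fin d × Fin d)))
        (Fin d × (Fin d × (Fin d × Fin d)))) : (∑ v, M v) ∘ₗ N = ∑ v, M v ∘ₗ N :=
    map_sum (LinearMap.lcomp ℂ (Op (Fin d × Fin d)) N) M _
  simp only [teleportation, h_sum_comp, Fintype.sum_prod_type, ← conjMap_one,
    tensorMap_conjMap, conjMap_comp, ← Matrix.mul_kronecker_mul, Matrix.one_mul, Matrix.mul_one,
    teleportationKraus]

theorem teleportationKraus_mul_attachKraus_apply (U V : Op (Fin d))
    (ψ : (Fin d × Fin d) × (Fin d × Fin d) → ℂ) (i j x y : Fin d) :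
    (teleportationKraus U V * (attachKraus ψ : Matrix _ (Fin d × Fin d) ℂ)) (i, j) (x, y) =
      ∑ p, ∑ q, (d : ℂ)⁻¹ * ((star (U x p.1) * U j q.1) * (star (V y q.2) * V i p.2)) *
        ψ (p, q) := by
  rw [mul_attachKraus_apply]
  refine Finset.sum_congr rfl fun p _ => Finset.sum_congr rfl fun q _ => ?_
  rw [teleportationKraus, Matrix.kroneckerMap_apply, bobKraus, Matrix.submatrix_apply,
    mul_bellKraus_apply, mul_bellKraus_apply, ← inv_sqrt_mul_inv_sqrt]
  dsimp only [id, Prod.map_apply, Prod.swap]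
  ring

theorem sum_teleportationKraus_mul_attachKraus {ι : Type*} [Fintype ι] {W : ι → Op (Fin d)}
    (hW : IsUnitaryOperatorBasis W) (ψ : (Fin d × Fin d) × (Fin d × Fin d) → ℂ) :
    ∑ x : ι × ι, teleportationKraus (W x.1) (W x.2) * (attachKraus ψ : Matrix _ (Fin d × Fin d) ℂ) =
      ((d : ℂ) * ∑ p, ψ (p, p)) • swapOp d := by
  ext ⟨i, j⟩ ⟨x, y⟩
  have h_sum (p q : Fin d × Fin d) :
      ∑ u, ∑ v, (d : ℂ)⁻¹ * ((star (W u x p.1) * W u j q.1) * (star (W v y q.2) * W v i p.2)) *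
        ψ (p, q) = if q = p then (if x = j ∧ y = i then (d : ℂ) * ψ (p, q) else 0) else 0 := by
    simp only [← Finset.mul_sum, ← Finset.sum_mul, hW.sum_star_mul, Fintype.card_fin]
    rcases eq_or_ne d 0 with rfl | hd
    · exact x.elim0
    have hd' : (d : ℂ) ≠ 0 := Nat.cast_ne_zero.2 hd
    grind
  simp only [Matrix.sum_apply, teleportationKraus_mul_attachKraus_apply]
  rw [Finset.sum_comm, Finset.sum_congr rfl fun p _ => Finset.sum_comm]
  simp only [Fintype.sum_prod_type (α₁ := ι), h_sum, Finset.sum_ite_eq', Finset.mem_univ, if_true,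
    Finset.sum_ite_irrel, Finset.sum_const_zero, ← Finset.mul_sum, Matrix.smul_apply, swapOp_apply,
    smul_eq_mul, mul_ite, mul_one, mul_zero, Prod.swap_prod_mk, Prod.mk.injEq]
  exact if_congr (and_congr eq_comm eq_comm) rfl rfl

theorem isCP_simulation_teleportation_sub (hd : d ≠ 0) {W : Fin (d * d) → Op (Fin d)}
    (hW : IsUnitaryOperatorBasis W) (ψ : (Fin d × Fin d) × (Fin d × Fin d) → ℂ) :
    IsCP (simulation (teleportation W) (Matrix.vecMulVec ψ (star ψ)) -
      ((‖∑ p, ψ (p, p)‖ ^ 2 / d ^ 2 : ℝ) : ℂ) • swapChannel d) := by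
  have h_kraus : simulation (teleportation W) (Matrix.vecMulVec ψ (star ψ)) =
      ∑ x : Fin (d * d) × Fin (d * d), conjMap (teleportationKraus (W x.1) (W x.2) *
        (attachKraus ψ : Matrix _ (Fin d × Fin d) ℂ)) := by
    rw [simulation, teleportation_eq_sum_conjMap, attach_vecMulVec]
    exact (map_sum (LinearMap.lcomp ℂ (Op (Fin d × Fin d)) (conjMap (attachKraus ψ))) _ _).trans
      (Finset.sum_congr rfl fun x _ => conjMap_comp ..)
  have h := (isCP_card_smul_sum_conjMap_sub fun x : Fin (d * d) × Fin (d * d) =>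
    teleportationKraus (W x.1) (W x.2) * (attachKraus ψ : Matrix _ (Fin d × Fin d) ℂ)).smul
      (t := ((d : ℂ) ^ 4)⁻¹) (by positivity)
  have hd' : (d : ℂ) ≠ 0 := Nat.cast_ne_zero.2 hd
  convert h using 1
  rw [h_kraus, sum_teleportationKraus_mul_attachKraus hW, conjMap_smul, ← swapChannel_eq_conjMap,
    smul_sub, smul_smul, smul_smul, Complex.star_def, Complex.mul_conj', norm_mul,
    Fintype.card_prod, Fintype.card_fin, Complex.norm_natCast]
  push_cast
  congr 2
  · rw [show ((d : ℂ) ^ 4)⁻¹ * (d * d * (d * d)) = 1 by field_simp, one_smul]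
  · field_simp

end Teleportation

section LOCCProtocols

theorem IsLOCC.exists_simulation_eq {a b r s a' b' r' s' : Type} [Fintype a] [DecidableEq a]
    [Fintype b] [DecidableEq b] [Fintype r] [DecidableEq r] [Fintype s] [DecidableEq s]
    [Fintype a'] [Fintype b'] [Fintype r'] [DecidableEq r'] [Fintype s'] [DecidableEq s']
    {L : SuperOp ((a × r) × (b × s)) (a' × b')} (hL : IsLOCC L) {E : SuperOp r' r}
    {G : SuperOp s' s} (hE : IsChannel E) (hG : IsChannel G) :
    ∃ L' : SuperOp ((a × r') × (b × s')) (a' × b'), IsLOCC L' ∧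
      ∀ ρ, simulation L' ρ = simulation L (tensorMap E G ρ) :=
  ⟨_, hL.comp_tensorMap ⟨IsCP.id.tensor hE.1, IsTP.id.tensor hE.2⟩
    ⟨IsCP.id.tensor hG.1, IsTP.id.tensor hG.2⟩, simulation_comp_tensorMap L E G⟩

variable {d D : ℕ}

theorem exists_isLOCC_forall_vecMulVec (hd : d ≠ 0) :
    ∃ L : SuperOp ((Fin d × (Fin d × Fin d)) × (Fin d × (Fin d × Fin d))) (Fin d × Fin d),
      IsLOCC L ∧ ∀ ψ : (Fin d × Fin d) × (Fin d × Fin d) → ℂ,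
        IsCP (simulation L (Matrix.vecMulVec ψ (star ψ)) -
          ((‖∑ p, ψ (p, p)‖ ^ 2 / d ^ 2 : ℝ) : ℂ) • swapChannel d) := by
  obtain ⟨W, hW⟩ := exists_isUnitaryOperatorBasis d
  exact ⟨_, isLOCC_teleportation hd hW, isCP_simulation_teleportation_sub hd hW⟩

theorem exists_real_isometry {m n : Type*} [Fintype m] [Fintype n] [DecidableEq n]
    (h : Fintype.card n ≤ Fintype.card m) :
    ∃ J : Matrix m n ℂ, Jᴴ = Jᵀ ∧ Jᵀ * J = 1 := by
  classical
  obtain ⟨ι⟩ := Function.Embedding.nonempty_of_card_le h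
  refine ⟨(1 : Matrix m m ℂ).submatrix id ι, ?_, ?_⟩
  · rw [Matrix.conjTranspose_submatrix, Matrix.conjTranspose_one, Matrix.transpose_submatrix,
      Matrix.transpose_one]
  · rw [Matrix.transpose_submatrix, Matrix.transpose_one, ← Matrix.submatrix_mul _ _ _ id _
      Function.bijective_id, Matrix.mul_one, Matrix.submatrix_one ι ι.injective]

theorem exists_isLOCC_maxEntangled (hd : d ≠ 0) (hDd : D ≤ d ^ 2) :
    ∃ L : SuperOp ((Fin d × Fin D) × (Fin d × Fin D)) (Fin d × Fin d), IsLOCC L ∧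
      IsCP (simulation L (maxEntangled D) - ((D / d ^ 2 : ℝ) : ℂ) • swapChannel d) := by
  obtain ⟨L, hL, h_sub⟩ := exists_isLOCC_forall_vecMulVec hd
  obtain ⟨J, hJ_real, hJ⟩ :=
    exists_real_isometry (m := Fin d × Fin d) (n := Fin D) (by simpa [← sq])
  have hE : IsChannel (conjMap J) := isChannel_conjMap (hJ_real ▸ hJ)
  obtain ⟨L', hL', h_sim⟩ := hL.exists_simulation_eq hE hE
  refine ⟨L', hL', ?_⟩
  have h_overlap : ∑ p, ((J ⊗ₖ J) *ᵥ entangledVec (Equiv.refl (Fin D))) (p, p) = D := by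
    have h_vec : entangledVec (Equiv.refl (Fin D)) = Matrix.vec 1 := by
      ext p
      exact if_congr eq_comm rfl rfl
    calc ∑ p, ((J ⊗ₖ J) *ᵥ entangledVec (Equiv.refl (Fin D))) (p, p) = (J * Jᵀ).trace := by
          rw [h_vec, Matrix.kronecker_mulVec_vec, Matrix.mul_one]
          rfl
      _ = D := by rw [Matrix.trace_mul_comm, hJ, Matrix.trace_one, Fintype.card_fin]
  have h := (h_sub ((J ⊗ₖ J) *ᵥ entangledVec (Equiv.refl (Fin D)))).smul (t := (D : ℂ)⁻¹)
    (by positivity)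
  rw [h_overlap, ← conjMap_vecMulVec, ← tensorMap_conjMap, ← h_sim, smul_sub,
    ← simulationLinear_apply, ← map_smul, ← maxEntangled_eq_smul_vecMulVec] at h
  convert h using 2
  · rfl
  rw [smul_smul, Complex.norm_natCast]
  congr 1
  push_cast
  rcases eq_or_ne D 0 with rfl | hD
  · simp
  · field_simp

theorem exists_isLOCC_isotropicState (hd : d ≠ 0) (hDd : D ≤ d ^ 2) (hD : 2 ≤ D) {F : ℝ}
    (hF₀ : 0 ≤ F) (hF₁ : F ≤ 1) :
    ∃ L : SuperOp ((Fin d × Fin D) × (Fin d × Fin D)) (Fin d × Fin d), IsLOCC L ∧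
      IsCP (simulation L (isotropicState D F) - ((F * D / d ^ 2 : ℝ) : ℂ) • swapChannel d) := by
  obtain ⟨L, hL, h_sub⟩ := exists_isLOCC_maxEntangled hd hDd
  refine ⟨L, hL, ?_⟩
  have h_rest := hL.isCPPTP.1.1.simulation (posSemidef_one_sub_maxEntangled (D := D) (by omega))
  have h_coeff : (0 : ℝ) ≤ (1 - F) / (D ^ 2 - 1) := 
    div_nonneg (sub_nonneg.2 hF₁) (by have : (2 : ℝ) ≤ D := mod_cast hD; nlinarith)
  convert (h_sub.smul (Complex.zero_le_real.2 hF₀)).add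
    (h_rest.smul (Complex.zero_le_real.2 h_coeff)) using 1
  rw [isotropicState, ← simulationLinear_apply, map_add, map_smul, map_smul]
  simp only [simulationLinear_apply]
  rw [smul_sub, smul_smul, add_sub_right_comm]
  push_cast
  rw [mul_div_assoc]

theorem exists_isLOCC_one_div (hd : d ≠ 0) {ρ : Op (Fin D × Fin D)} (hρ : ρ.trace = 1) :
    ∃ L : SuperOp ((Fin d × Fin D) × (Fin d × Fin D)) (Fin d × Fin d), IsLOCC L ∧
      IsCP (simulation L ρ - ((1 / d ^ 2 : ℝ) : ℂ) • swapChannel d) := by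
  obtain ⟨L, hL, h_sub⟩ := exists_isLOCC_forall_vecMulVec hd
  have : NeZero d := ⟨hd⟩
  let v : Fin d × Fin d → ℂ := Pi.single (0, 0) 1
  have h_state : IsState (Matrix.vecMulVec v (star v)) :=
    ⟨Matrix.posSemidef_vecMulVec_self_star v, by simp [v, Matrix.trace_vecMulVec]⟩
  obtain ⟨L', hL', h_sim⟩ := hL.exists_simulation_eq (isChannel_replacer (a := Fin D) h_state)
    (isChannel_replacer (a := Fin D) h_state)
  refine ⟨L', hL', ?_⟩
  have h_kronecker : Matrix.vecMulVec v (star v) ⊗ₖ Matrix.vecMulVec v (star v) =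
      Matrix.vecMulVec (fun p => v p.1 * v p.2) (star fun p => v p.1 * v p.2) := by
    ext p q
    simp only [Matrix.kroneckerMap_apply, Matrix.vecMulVec_apply, Pi.star_apply, star_mul']
    ring
  have h_overlap : ∑ p, v p * v p = 1 := by simp [v, Pi.single_apply]
  have h := h_sub fun p => v p.1 * v p.2
  rw [h_overlap, norm_one, one_pow] at h
  rwa [h_sim, tensorMap_replacer, replacer_apply, hρ, one_smul, h_kronecker]

end LOCCProtocols

section Contraction

variable {a b r s : Type} [Fintype r] [Fintype s]

/-- The map `X ↦ Tr_{ÂB̂} (X (1 ⊗ Q))` describing the outcome `Q` of a measurement of the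
resource systems, linearly in `Q`. -/
def contraction : Op (r × s) →ₗ[ℂ] SuperOp ((a × r) × (b × s)) (a × b) :=
  LinearMap.mk₂ ℂ
    (fun Q X => Matrix.of fun z z' =>
      (X.submatrix (fun p : r × s => ((z.1, p.1), (z.2, p.2)))
        (fun p : r × s => ((z'.1, p.1), (z'.2, p.2))) * Q).trace)
    (fun Q Q' X => by ext; simp [mul_add])
    (fun t Q X => by ext; simp)
    (fun Q X X' => by ext; simp [Matrix.submatrix_add, add_mul])
    (fun t Q X => by ext; simp [Matrix.submatrix_smul])

theorem contraction_apply (Q : Op (r × s)) (X : Op ((a × r) × (b × s))) (z z' : a × b) :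
    contraction Q X z z' =
      (X.submatrix (fun p : r × s => ((z.1, p.1), (z.2, p.2)))
        (fun p : r × s => ((z'.1, p.1), (z'.2, p.2))) * Q).trace := rfl

theorem contraction_comp_attach (Q ρ : Op (r × s)) :
    contraction Q ∘ₗ attach ρ = (ρ * Q).trace • (LinearMap.id : SuperOp (a × b) (a × b)) := by
  ext1 X
  ext z z'
  have h_block : (attach ρ X).submatrix (fun p : r × s => ((z.1, p.1), (z.2, p.2)))
      (fun p : r × s => ((z'.1, p.1), (z'.2, p.2))) = X z z' • ρ := rfl
  rw [LinearMap.comp_apply, contraction_apply, h_block, smul_mul_assoc, Matrix.trace_smul,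
    smul_eq_mul, mul_comm]
  rfl

theorem bobTranspose_contraction (Q : Op (r × s)) :
    bobTranspose (contraction Q : SuperOp _ (a × b)) = contraction (partialTranspose r s Q) := by
  ext1 X
  ext z z'
  exact (trace_partialTranspose_mul_partialTranspose _ _).symm

theorem trace_contraction_one [Fintype a] [Fintype b] [DecidableEq r] [DecidableEq s]
    (X : Op ((a × r) × (b × s))) :
    (contraction 1 X : Op (a × b)).trace = X.trace := by
  rw [← trace_submatrix_equiv X (Equiv.prodProdProdComm a b r s)]
  simp only [Matrix.trace, Matrix.diag_apply, contraction_apply, mul_one, Matrix.submatrix_apply,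
    Fintype.sum_prod_type, Equiv.prodProdProdComm_apply]

theorem choi_contraction [DecidableEq a] [DecidableEq b] [DecidableEq r] [DecidableEq s]
    (Q : Op (r × s)) :
    choi (contraction Q : SuperOp _ (a × b)) =
      (Matrix.vecMulVec (entangledVec (Equiv.refl (a × b)))
          (star (entangledVec (Equiv.refl (a × b)))) ⊗ₖ Qᵀ).submatrix
        (fun p => (((p.1.1.1, p.1.2.1), p.2), (p.1.1.2, p.1.2.2)))
        (fun p => (((p.1.1.1, p.1.2.1), p.2), (p.1.1.2, p.1.2.2))) := by
  ext p q
  have h_block : (Matrix.single p.1 q.1 (1 : ℂ)).submatrix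
      (fun t : r × s => ((p.2.1, t.1), (p.2.2, t.2)))
      (fun t : r × s => ((q.2.1, t.1), (q.2.2, t.2))) =
      ((if (p.1.1.1, p.1.2.1) = p.2 then 1 else 0) *
          if (q.1.1.1, q.1.2.1) = q.2 then 1 else 0 : ℂ) •
        Matrix.single (p.1.1.2, p.1.2.2) (q.1.1.2, q.1.2.2) (1 : ℂ) := by
    ext t t'
    simp only [Matrix.submatrix_apply, Matrix.single_apply, Matrix.smul_apply, Prod.ext_iff,
      smul_eq_mul]
    grind
  rw [choi_apply, contraction_apply, h_block, star_entangledVec, smul_mul_assoc,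
    Matrix.trace_smul, Matrix.trace_single_mul, one_smul]
  rfl

theorem isCP_contraction [Fintype a] [DecidableEq a] [Fintype b] [DecidableEq b] [DecidableEq r]
    [DecidableEq s] {Q : Op (r × s)} (hQ : Q.PosSemidef) :
    IsCP (contraction Q : SuperOp _ (a × b)) := by
  rw [isCP_iff_posSemidef_choi, choi_contraction]
  exact ((Matrix.posSemidef_vecMulVec_self_star _).kronecker hQ.transpose).submatrix _

end Contraction

section TestAndApply

variable {a b r s a' b' : Type} [Fintype r] [DecidableEq r] [Fintype s] [DecidableEq s]

/-- The protocol that measures the effect `Q` on the resource and applies `M₀` if it occurs and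
`M₁` otherwise. -/
def testAndApply (Q : Op (r × s)) (M₀ M₁ : SuperOp (a × b) (a' × b')) :
    SuperOp ((a × r) × (b × s)) (a' × b') :=
  M₀ ∘ₗ contraction Q + M₁ ∘ₗ contraction (1 - Q)

theorem bobTranspose_testAndApply (Q : Op (r × s)) (M₀ M₁ : SuperOp (a × b) (a' × b')) :
    bobTranspose (testAndApply Q M₀ M₁) =
      testAndApply (partialTranspose r s Q) (bobTranspose M₀) (bobTranspose M₁) := by
  rw [testAndApply, map_add, bobTranspose_comp, bobTranspose_comp, bobTranspose_contraction,
    bobTranspose_contraction, map_sub, partialTranspose_one, testAndApply]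

theorem simulation_testAndApply (Q : Op (r × s)) (M₀ M₁ : SuperOp (a × b) (a' × b'))
    (ρ : Op (r × s)) :
    simulation (testAndApply Q M₀ M₁) ρ =
      (ρ * Q).trace • M₀ + (ρ.trace - (ρ * Q).trace) • M₁ := by
  rw [simulation, testAndApply, LinearMap.add_comp, LinearMap.comp_assoc, LinearMap.comp_assoc,
    contraction_comp_attach, contraction_comp_attach, LinearMap.comp_smul, LinearMap.comp_smul,
    LinearMap.comp_id, LinearMap.comp_id, mul_sub, mul_one, Matrix.trace_sub]

theorem testAndApply_smul_swapOp {D : ℕ} (t : ℂ) (N₀ N₁ : SuperOp (a × b) (a' × b')) :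
    testAndApply (t • swapOp D) N₀ N₁ =
      (1 / 2 : ℂ) • ((t • N₀ + (1 - t) • N₁) ∘ₗ contraction (1 + swapOp D) +
        (-t • N₀ + (1 + t) • N₁) ∘ₗ contraction (1 - swapOp D)) := by
  ext1 X
  simp only [testAndApply, map_sub, map_add, map_smul, LinearMap.add_apply, LinearMap.sub_apply,
    LinearMap.smul_apply, LinearMap.comp_apply]
  module

variable [Fintype a] [DecidableEq a] [Fintype b] [DecidableEq b] [Fintype a'] [Fintype b']

theorem isChannel_testAndApply {Q : Op (r × s)} (hQ : Q.PosSemidef)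
    (hQ' : (1 - Q).PosSemidef) {M₀ M₁ : SuperOp (a × b) (a' × b')} (hM₀ : IsChannel M₀)
    (hM₁ : IsChannel M₁) : IsChannel (testAndApply Q M₀ M₁) := by
  refine ⟨(hM₀.1.comp (isCP_contraction hQ)).add (hM₁.1.comp (isCP_contraction hQ')), fun X => ?_⟩
  rw [testAndApply, LinearMap.add_apply, Matrix.trace_add, LinearMap.comp_apply,
    LinearMap.comp_apply, hM₀.2, hM₁.2, ← Matrix.trace_add, ← LinearMap.add_apply, ← map_add,
    add_sub_cancel, trace_contraction_one]

theorem isCPPTP_testAndApply_maxEntangled {D : ℕ} (hD : D ≠ 0)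
    {M₀ M₁ : SuperOp (a × b) (a' × b')} (hM₀ : IsChannel M₀) (hM₁ : IsChannel M₁)
    (h_symm : IsCP ((((D : ℝ)⁻¹ : ℝ) : ℂ) • bobTranspose M₀ +
      ((1 - (D : ℝ)⁻¹ : ℝ) : ℂ) • bobTranspose M₁))
    (h_antisymm : IsCP (((-(D : ℝ)⁻¹ : ℝ) : ℂ) • bobTranspose M₀ +
      ((1 + (D : ℝ)⁻¹ : ℝ) : ℂ) • bobTranspose M₁)) :
    IsCPPTP (testAndApply (maxEntangled D) M₀ M₁) := by
  refine ⟨isChannel_testAndApply (posSemidef_maxEntangled D) (posSemidef_one_sub_maxEntangled hD)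
    hM₀ hM₁, ?_⟩
  change IsCP (bobTranspose _)
  have h_add : (1 + swapOp D).PosSemidef := by
    simpa [swapOp_eq_permMatrix] using posSemidef_one_add_smul_permMatrix
      (σ := Equiv.prodComm (Fin D) (Fin D)) rfl (mul_one 1)
  have h_sub : (1 - swapOp D).PosSemidef := by
    simpa [swapOp_eq_permMatrix, sub_eq_add_neg] using posSemidef_one_add_smul_permMatrix
      (σ := Equiv.prodComm (Fin D) (Fin D)) rfl (by norm_num : (-1 : ℝ) * -1 = 1)
  rw [bobTranspose_testAndApply, partialTranspose_maxEntangled, testAndApply_smul_swapOp]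
  push_cast at h_symm h_antisymm
  exact ((h_symm.comp (isCP_contraction h_add)).add
    (h_antisymm.comp (isCP_contraction h_sub))).smul (by positivity)

end TestAndApply

section DepolarizedSwap

variable {d D : ℕ}

/-- The mixture `(1 - d² y) S + y (Tr ·) 1` of the swap channel with the fully depolarizing map. -/
def depolarizedSwap (d : ℕ) (y : ℝ) : SuperOp (Fin d × Fin d) (Fin d × Fin d) :=
  ((1 - d ^ 2 * y : ℝ) : ℂ) • swapChannel d + (y : ℂ) • replacer (Fin d × Fin d) 1

theorem depolarizedSwap_eq_add (hd : d ≠ 0) (y : ℝ) :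
    depolarizedSwap d y = ((1 - d ^ 2 * y + y / d ^ 2 : ℝ) : ℂ) • swapChannel d +
      ((y / d ^ 2 : ℝ) : ℂ) • ((d : ℂ) ^ 2 • replacer (Fin d × Fin d) 1 - swapChannel d) := by
  have : (d : ℂ) ≠ 0 := Nat.cast_ne_zero.2 hd
  rw [depolarizedSwap]
  push_cast
  match_scalars <;> field_simp
  ring

theorem isChannel_depolarizedSwap (hd : d ≠ 0) {y : ℝ} (hy : 0 ≤ y)
    (h : 0 ≤ 1 - d ^ 2 * y + y / d ^ 2) : IsChannel (depolarizedSwap d y) := by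
  refine ⟨?_, fun X => ?_⟩
  · rw [depolarizedSwap_eq_add hd]
    exact ((isChannel_swapChannel d).1.smul (Complex.zero_le_real.2 h)).add
      ((isCP_sq_smul_replacer_one_sub_swapChannel d).smul
        (Complex.zero_le_real.2 (by positivity)))
  · rw [depolarizedSwap, LinearMap.add_apply, LinearMap.smul_apply, LinearMap.smul_apply,
      replacer_apply, Matrix.trace_add, Matrix.trace_smul, Matrix.trace_smul, Matrix.trace_smul,
      (isChannel_swapChannel d).2, trace_one_fin_prod_fin, smul_eq_mul, smul_eq_mul, smul_eq_mul]
    push_cast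
    ring

theorem isCP_smul_add_smul_bobTranspose_depolarizedSwap {u v y : ℝ}
    (h : |u + v * (1 - d ^ 2 * y)| ≤ v * y) :
    IsCP ((u : ℂ) • bobTranspose (swapChannel d) +
      (v : ℂ) • bobTranspose (depolarizedSwap d y)) := by
  convert isCP_smul_bobTranspose_swapChannel_add_smul_replacer_one d h using 1
  rw [depolarizedSwap, map_add, map_smul, map_smul, bobTranspose_replacer, partialTranspose_one]
  push_cast
  module

end DepolarizedSwap

section PPTProtocol

variable {d D : ℕ}

/-- The weight of the depolarizing part of the map applied when the test for the maximally entangled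
state fails, chosen to saturate the PPT condition on the symmetric subspace of the resource. -/
def swapNoise (d D : ℕ) : ℝ :=
  D / ((D - 1) * (d ^ 2 + 1))

theorem swapNoise_nonneg (hD : D ≠ 0) : 0 ≤ swapNoise d D := by
  have : (1 : ℝ) ≤ D := by exact_mod_cast Nat.one_le_iff_ne_zero.2 hD
  exact div_nonneg D.cast_nonneg (mul_nonneg (by linarith) (by positivity))

theorem inv_add_mul_one_sub_sq_mul_swapNoise (hD : 2 ≤ D) :
    (D : ℝ)⁻¹ + (1 - (D : ℝ)⁻¹) * (1 - d ^ 2 * swapNoise d D) =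
      (1 - (D : ℝ)⁻¹) * swapNoise d D := by
  have h₀ : (D : ℝ) ≠ 0 := by exact_mod_cast (by omega : D ≠ 0)
  have h₁ : (D : ℝ) - 1 ≠ 0 := sub_ne_zero.2 (by exact_mod_cast (by omega : D ≠ 1))
  rw [swapNoise]
  field_simp
  ring

theorem one_sub_sq_mul_swapNoise_add_div (hd : d ≠ 0) (hD : 2 ≤ D) :
    1 - d ^ 2 * swapNoise d D + swapNoise d D / d ^ 2 = 1 - (1 - 1 / d ^ 2) / (1 - 1 / D) := by
  have h₀ : (D : ℝ) ≠ 0 := by exact_mod_cast (by omega : D ≠ 0)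
  have h₁ : (D : ℝ) - 1 ≠ 0 := sub_ne_zero.2 (by exact_mod_cast (by omega : D ≠ 1))
  rw [swapNoise, one_sub_div h₀]
  field_simp
  ring

theorem abs_neg_inv_add_mul_one_sub_sq_mul_swapNoise_le (hD : 2 ≤ D) (hDd : d ^ 2 ≤ D) :
    |-(D : ℝ)⁻¹ + (1 + (D : ℝ)⁻¹) * (1 - d ^ 2 * swapNoise d D)| ≤
      (1 + (D : ℝ)⁻¹) * swapNoise d D := by
  have hD₂ : (2 : ℝ) ≤ D := mod_cast hD
  have hDd' : (d : ℝ) ^ 2 ≤ D := mod_cast hDd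
  have hD_sub : (0 : ℝ) < D - 1 := by linarith
  have h_noise : 1 - d ^ 2 * swapNoise d D = swapNoise d D - 1 / (D - 1) := by
    rw [swapNoise]
    field_simp
    ring
  have h_le : 1 / (D - 1 : ℝ) ≤ (1 + (D : ℝ)⁻¹) * swapNoise d D := by
    rw [swapNoise]
    field_simp
    linarith
  rw [h_noise, abs_le]
  have h_inv : (D : ℝ)⁻¹ + (1 + (D : ℝ)⁻¹) * (1 / (D - 1)) = 2 * (1 / (D - 1)) := by
    field_simp
    ring
  have : 0 ≤ (D : ℝ)⁻¹ := by positivity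
  have : 0 ≤ (1 + (D : ℝ)⁻¹) * (1 / (D - 1)) := by positivity
  constructor <;> linarith

/-- The swap is applied if the resource passes the test for the maximally entangled state, and the
noisy swap otherwise. -/
def pptProtocol (d D : ℕ) : SuperOp ((Fin d × Fin D) × (Fin d × Fin D)) (Fin d × Fin d) :=
  testAndApply (maxEntangled D) (swapChannel d) (depolarizedSwap d (swapNoise d D))

theorem isCPPTP_pptProtocol (hd : d ≠ 0) (hD : 2 ≤ D) (hDd : d ^ 2 ≤ D) :
    IsCPPTP (pptProtocol d D) := by
  have hD₀ : D ≠ 0 := by omega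
  have h_inv : (D : ℝ)⁻¹ < 1 := inv_lt_one_of_one_lt₀ (by exact_mod_cast hD)
  have h_weight : 0 ≤ 1 - d ^ 2 * swapNoise d D + swapNoise d D / d ^ 2 := by
    rw [one_sub_sq_mul_swapNoise_add_div hd hD, sub_nonneg, one_div (D : ℝ)]
    refine div_le_one_of_le₀ (sub_le_sub_left ?_ 1) (sub_nonneg.2 h_inv.le)
    rw [← one_div]
    exact one_div_le_one_div_of_le (by positivity) (mod_cast hDd)
  refine isCPPTP_testAndApply_maxEntangled hD₀ (isChannel_swapChannel d)
    (isChannel_depolarizedSwap hd (swapNoise_nonneg hD₀) h_weight)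
    (isCP_smul_add_smul_bobTranspose_depolarizedSwap ?_)
    (isCP_smul_add_smul_bobTranspose_depolarizedSwap
      (abs_neg_inv_add_mul_one_sub_sq_mul_swapNoise_le hD hDd))
  rw [inv_add_mul_one_sub_sq_mul_swapNoise hD,
    abs_of_nonneg (mul_nonneg (sub_nonneg.2 h_inv.le) (swapNoise_nonneg hD₀))]

theorem isCP_simulation_pptProtocol_sub (hd : d ≠ 0) (hD : 2 ≤ D) {F : ℝ} (hF₁ : F ≤ 1) :
    IsCP (simulation (pptProtocol d D) (isotropicState D F) -
      ((1 - (1 - 1 / d ^ 2) * (1 - F) / (1 - 1 / D) : ℝ) : ℂ) • swapChannel d) := by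
  have hD₀ : D ≠ 0 := by omega
  have h_noise : 0 ≤ (1 - F) * (swapNoise d D / d ^ 2) :=
    mul_nonneg (sub_nonneg.2 hF₁) (div_nonneg (swapNoise_nonneg hD₀) (sq_nonneg _))
  convert (isCP_sq_smul_replacer_one_sub_swapChannel d).smul (Complex.zero_le_real.2 h_noise)
    using 1
  rw [pptProtocol, simulation_testAndApply, trace_isotropicState_mul_maxEntangled hD₀,
    trace_isotropicState hD, depolarizedSwap_eq_add hd, one_sub_sq_mul_swapNoise_add_div hd hD]
  push_cast
  module

end PPTProtocol

section Errors

variable {d D : ℕ} {F p : ℝ}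

theorem sInf_diamondDist_swapChannel_eq
    {r s : Type} [Fintype r] [DecidableEq r] [Fintype s] [DecidableEq s]
    {C : SuperOp ((Fin d × r) × (Fin d × s)) (Fin d × Fin d) → Prop} (hd : d ≠ 0)
    {ρ : Op (r × s)} (hρ : IsState ρ) (hp : p ≤ 1) (hC : ∀ P, C P → IsChannel P)
    (h_le : ∀ P, C P → (swapFidelity d (simulation P ρ)).re ≤ p)
    (h_exists : ∃ P, C P ∧ IsCP (simulation P ρ - (p : ℂ) • swapChannel d)) :
    sInf {e : ℝ | ∃ P, C P ∧ e = 1 / 2 * diamondDist (swapChannel d) (simulation P ρ)} =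
      1 - p := by
  have h_lower : ∀ P, C P → 1 - p ≤ 1 / 2 * diamondDist (swapChannel d) (simulation P ρ) :=
    fun P hP => by
      linarith [h_le P hP, le_diamondDist_swapChannel hd ((hC P hP).simulation hρ)]
  obtain ⟨P, hP, hP_cp⟩ := h_exists
  have h_upper := diamondDist_le_of_isCP_sub_smul (isChannel_swapChannel d)
    ((hC P hP).simulation hρ).2 hp hP_cp
  refine IsLeast.csInf_eq ⟨⟨P, hP, (h_lower P hP).antisymm (by linarith)⟩, ?_⟩
  rintro e ⟨P, hP, rfl⟩
  exact h_lower P hP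

theorem errPPT_isotropicState_eq_of_lt (hd : d ≠ 0) (hD : 2 ≤ D) (hF : 1 / D < F) (hF₁ : F ≤ 1)
    (hDd : d ^ 2 < D) :
    errPPT (swapChannel d) (isotropicState D F) = (1 - 1 / d ^ 2) * (1 - F) / (1 - 1 / D) := by
  have hD₁ : 1 / (D : ℝ) ≤ 1 := hF.le.trans hF₁
  have hF₀ : 0 ≤ F := (by positivity : (0 : ℝ) ≤ 1 / D).trans hF.le
  have hd₁ : 1 / (d : ℝ) ^ 2 ≤ 1 :=
    div_le_one_of_le₀ (one_le_pow₀ (by exact_mod_cast Nat.one_le_iff_ne_zero.2 hd)) (by positivity)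
  have hp : 1 - (1 - 1 / (d : ℝ) ^ 2) * (1 - F) / (1 - 1 / D) ≤ 1 :=
    sub_le_self _ (div_nonneg (mul_nonneg (sub_nonneg.2 hd₁) (sub_nonneg.2 hF₁))
      (sub_nonneg.2 hD₁))
  exact (sInf_diamondDist_swapChannel_eq hd (isState_isotropicState hD hF₀ hF₁) hp
    (fun P hP => hP.1)
    (fun P hP => re_swapFidelity_simulation_isotropicState_le hd hD hP hF.le hF₁)
    ⟨pptProtocol d D, isCPPTP_pptProtocol hd hD hDd.le,
      isCP_simulation_pptProtocol_sub hd hD hF₁⟩).trans (sub_sub_cancel _ _)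

theorem errPPT_and_errLOCC_isotropicState_eq (hd : d ≠ 0) (hD : 2 ≤ D) (hF₀ : 0 ≤ F) (hF₁ : F ≤ 1)
    (hp : p ≤ 1) (h_max : max 1 (F * D) / d ^ 2 ≤ p)
    (h_exists : ∃ L, IsLOCC L ∧
      IsCP (simulation L (isotropicState D F) - (p : ℂ) • swapChannel d)) :
    errPPT (swapChannel d) (isotropicState D F) = 1 - p ∧
      errLOCC (swapChannel d) (isotropicState D F) = 1 - p := by
  have hρ := isState_isotropicState hD hF₀ hF₁
  have h_le : ∀ P : SuperOp ((Fin d × Fin D) × (Fin d × Fin D)) (Fin d × Fin d), IsCPPTP P →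
      (swapFidelity d (simulation P (isotropicState D F))).re ≤ p := fun P hP =>
    (re_swapFidelity_simulation_isotropicState_le_max hD hP hF₀).trans h_max
  refine ⟨sInf_diamondDist_swapChannel_eq hd hρ hp (fun P hP => hP.1) h_le ?_,
    sInf_diamondDist_swapChannel_eq hd hρ hp (fun L hL => hL.isCPPTP.1)
      (fun L hL => h_le L hL.isCPPTP) h_exists⟩
  obtain ⟨L, hL, hL_cp⟩ := h_exists
  exact ⟨L, hL.isCPPTP, hL_cp⟩

theorem errPPT_and_errLOCC_isotropicState_eq_of_le (hd : d ≠ 0) (hD : 2 ≤ D) (hF₀ : 0 ≤ F)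
    (hF₁ : F ≤ 1) (hF : F ≤ 1 / D) :
    errPPT (swapChannel d) (isotropicState D F) = 1 - 1 / d ^ 2 ∧
      errLOCC (swapChannel d) (isotropicState D F) = 1 - 1 / d ^ 2 := by
  have hFD : F * D ≤ 1 := by rwa [le_div_iff₀ (by positivity)] at hF
  refine errPPT_and_errLOCC_isotropicState_eq hd hD hF₀ hF₁ ?_ (by rw [max_eq_left hFD])
    (exists_isLOCC_one_div hd (trace_isotropicState hD F))
  exact div_le_one_of_le₀ (one_le_pow₀ (by exact_mod_cast Nat.one_le_iff_ne_zero.2 hd))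
    (by positivity)

theorem errPPT_and_errLOCC_isotropicState_eq_of_lt (hd : d ≠ 0) (hD : 2 ≤ D) (hF : 1 / D < F)
    (hF₁ : F ≤ 1) (hDd : D ≤ d ^ 2) :
    errPPT (swapChannel d) (isotropicState D F) = 1 - F * D / d ^ 2 ∧
      errLOCC (swapChannel d) (isotropicState D F) = 1 - F * D / d ^ 2 := by
  have hF₀ : 0 ≤ F := (by positivity : (0 : ℝ) ≤ 1 / D).trans hF.le
  have hFD : 1 ≤ F * D := by
    rw [div_lt_iff₀ (by positivity)] at hF
    exact hF.le
  refine errPPT_and_errLOCC_isotropicState_eq hd hD hF₀ hF₁ ?_ (by rw [max_eq_right hFD])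
    (exists_isLOCC_isotropicState hd hDd hD hF₀ hF₁)
  exact div_le_one_of_le₀
    ((mul_le_of_le_one_left D.cast_nonneg hF₁).trans (mod_cast hDd)) (by positivity)

end Errors

end Teleport

end

theorem mainTheorem5 (d D : ℕ) (hd : 1 ≤ d) (hD : 2 ≤ D) (F : ℝ) (hF0 : 0 ≤ F) (hF1 : F ≤ 1) :
    (F ≤ 1 / (D : ℝ) →
      Teleport.errPPT (Teleport.swapChannel d) (Teleport.isotropicState D F) =
        1 - 1 / (d : ℝ) ^ 2) ∧
    (1 / (D : ℝ) < F → D ≤ d ^ 2 →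
      Teleport.errPPT (Teleport.swapChannel d) (Teleport.isotropicState D F) =
        1 - F * (D : ℝ) / (d : ℝ) ^ 2) ∧
    (1 / (D : ℝ) < F → d ^ 2 < D →
      Teleport.errPPT (Teleport.swapChannel d) (Teleport.isotropicState D F) =
        (1 - 1 / (d : ℝ) ^ 2) * (1 - F) / (1 - 1 / (D : ℝ))) ∧
    (F ≤ 1 / (D : ℝ) ∨ (1 / (D : ℝ) < F ∧ D ≤ d ^ 2) →
      Teleport.errPPT (Teleport.swapChannel d) (Teleport.isotropicState D F) =
        Teleport.errLOCC (Teleport.swapChannel d) (Teleport.isotropicState D F)) := by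
  have hd₀ : d ≠ 0 := Nat.one_le_iff_ne_zero.1 hd
  have h_classical := Teleport.errPPT_and_errLOCC_isotropicState_eq_of_le hd₀ hD hF0 hF1
  have h_teleport := fun hF => Teleport.errPPT_and_errLOCC_isotropicState_eq_of_lt hd₀ hD hF hF1
  refine ⟨fun hF => (h_classical hF).1, fun hF hDd => (h_teleport hF hDd).1,
    fun hF hDd => Teleport.errPPT_isotropicState_eq_of_lt hd₀ hD hF hF1 hDd, ?_⟩
  rintro (hF | ⟨hF, hDd⟩)
  · exact (h_classical hF).1.trans (h_classical hF).2.symm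
  · exact (h_teleport hF hDd).1.trans (h_teleport hF hDd).2.symm
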